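/- **Setting.** Let $V$ and $H$ be real Hilbert spaces, $V\subset H$, the inclusion being continuous, dense and compact, and identify $H=H'$, so that $V\subset H\subset V'$. Let $A\in\mathcal L(V,V')$ be symmetric and such that $(y,z)\mapsto\langle Ay,z\rangle$ is a complete scalar product on $V$. Endow $V$ with the scalar product $(y,z)_V=\langle Ay,z\rangle$, $V'$ with the corresponding dual norm, $\mathrm D(A)=\{v\in V\mid Av\in H\}$ with the norm $\|v\|_{\mathrm D(A)}=\|Av\|_H$, and $\mathrm D(A)'\supset V'$ with the corresponding dual norm. Then $A:\mathrm D(A)\to H$ is bijective, with inverse $A^{-1}$, and $A$ extends to $A: H\to \mathrm D(A)'$ by $\langle Ah,v\rangle=(h,Av)_H$. For an open interval $I$ put $W(I,X,Y)=\{f\in L^2(I,X)\mid \dot f\in L^2(I,Y)\}$, with $\dot f$ the distributional derivative. Let $\sigma:\mathbb N_+\to\mathbb N_+$ be strictly increasing, and for each $M\in\mathbb N_+$ let $\mathfrak d^{M,j}\in \mathrm D(A)'$, $1\le j\le M_\sigma:=\sigma(M)$, span a space of dimension $M_\sigma$. Suppose that for each $M$ there are $\Psi^{M,j}\in \mathrm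 D(A)$, $1\le j\le M_\sigma$, spanning a space of dimension $M_\sigma$, with $\langle\mathfrak d^{M,j},\Psi^{M,i}\rangle=1$ if $i=j$ and $=0$ if $i\neq j$, and that $$\xi_{M_+}:=\inf\Big\{\tfrac{\|\varTheta\|_{\mathrm D(A)}^2}{\|\varTheta\|_V^2}\;\Big|\;0\ne\varTheta\in \mathrm D(A),\ \langle\mathfrak d^{M,j},\varTheta\rangle=0\text{ for all }1\le j\le M_\sigma\Big\}\ \longrightarrow\ +\infty\qquad(M\to+\infty).$$ **Theorem.** There are functions $(\mu,C)\mapsto\overline M(\mu,C)\in\mathbb N_+$ and $(M,\mu,C)\mapsto\overline\lambda(M,\mu,C)\in(0,\infty)$, for $\mu,C\in[0,\infty)$ and $M\in\mathbb N_+$, nondecreasing in each of their arguments (and depending on nothing but $V,H,A$ and the actuators $\mathfrak d^{M,j}$), such that the following holds for every $\mu>0$ and $C_{\rm rc}\ge0$. Let $A_{\rm rc}(t)\in\mathcal L(H,V')$, $t>0$, be such that $t\mapsto\langle A_{\rm rc}(t)h,v\rangle$ is measurable for all $h\in H$, $v\in V$, and $\|A_{\rm rc}(t)\|_{\mathcal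 L(H,V')}\le C_{\rm rc}$ for almost every $t>0$. Let $M\ge\overline M(\mu,C_{\rm rc})$ and $\lambda\ge\overline\lambda(M,\mu,C_{\rm rc})$. Then, for every $y_0\in V'$, the system $$\dot y+Ay+A_{\rm rc}y=-\lambda\sum_{j=1}^{M_\sigma}\langle\mathfrak d^{M,j},A^{-1}y\rangle\,\mathfrak d^{M,j},\qquad y(0)=y_0,$$ has a unique solution $y\in C([0,\infty),V')$ which lies in $W((0,\tau),H,\mathrm D(A)')$ for all $\tau>0$ (the equation being understood in $\mathrm D(A)'$ for almost every $t>0$). This solution satisfies $y\in W((0,\infty),H,\mathrm D(A)')$, $$\|y(t)\|_{V'}\le \mathrm e^{-\mu(t-s)}\|y(s)\|_{V'}\quad\text{for all }t\ge s\ge0,$$ $$\|y\|_{L^2((s,\infty),H)}^2\le\big(2+\mu^{-1}C_{\rm rc}^2\big)\|y(s)\|_{V'}^2\quad\text{for all }s\ge0.$$ In particular one may take $M=\overline M(\mu,C_{\rm rc})$ and $\lambda=\overline\lambda(\overline M(\mu,C_{\rm rc}),\mu,C_{\rm rc})$, which are nondecreasing functions of $(\mu,C_{\rm rc})$. -/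

import Mathlib

open MeasureTheory Set Filter Topology
open scoped NNReal ContDiff

/-- A diffusion-like operator `A` in the Gelfand triple `V ⊆ H = H' ⊆ V'`: the Hilbert space `V` is
injected by `incl` continuously, densely and compactly into the Hilbert space `H`, and
`A ∈ L(V, V')` is symmetric and such that `(y, z) ↦ ⟨A y, z⟩` is a complete scalar product on `V`. -/
structure DiffusionOperator (V H : Type*)
    [NormedAddCommGroup V] [InnerProductSpace ℝ V] [CompleteSpace V]
    [NormedAddCommGroup H] [InnerProductSpace ℝ H] [CompleteSpace H] where
  incl : V →L[ℝ] H
  incl_injective : Function.Injective incl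
  incl_denseRange : DenseRange incl
  incl_compact : IsCompactOperator incl
  A : V →L[ℝ] StrongDual ℝ V
  symm : ∀ y z : V, A y z = A z y
  pos : ∀ y : V, y ≠ 0 → 0 < A y y
  complete : ∀ u : ℕ → V,
    (∀ ε : ℝ, 0 < ε → ∃ N : ℕ, ∀ m n : ℕ, N ≤ m → N ≤ n → A (u m - u n) (u m - u n) < ε) →
    ∃ v : V, Tendsto (fun n => A (u n - v) (u n - v)) atTop (𝓝 0)

namespace DiffusionOperator

variable {V H : Type*}
  [NormedAddCommGroup V] [InnerProductSpace ℝ V] [CompleteSpace V]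
  [NormedAddCommGroup H] [InnerProductSpace ℝ H] [CompleteSpace H]

/-- The space `V`, endowed with the scalar product `(y, z)_V = ⟨A y, z⟩`. -/
def Energy (_T : DiffusionOperator V H) : Type _ := V

/-- The scalar product `(y, z)_V = ⟨A y, z⟩`. -/
@[reducible] noncomputable def energyCore (T : DiffusionOperator V H) :
    InnerProductSpace.Core ℝ V where
  inner y z := T.A y z
  conj_inner_symm y z := by simpa using T.symm _ _
  re_inner_nonneg y := by
    by_cases h : y = 0
    · simp [h]
    · simpa using (T.pos _ h).le
  add_left x y z := by simp
  smul_left x y r := by simp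
  definite y h := by
    by_contra hy
    exact (T.pos y hy).ne' h

noncomputable instance (T : DiffusionOperator V H) : NormedAddCommGroup T.Energy :=
  @InnerProductSpace.Core.toNormedAddCommGroup ℝ V _ _ _ T.energyCore

noncomputable instance (T : DiffusionOperator V H) : InnerProductSpace ℝ T.Energy :=
  @InnerProductSpace.ofCore ℝ V _ _ _ T.energyCore.toCore

/-- The identity, from `V` with the scalar product `⟨A y, z⟩` to `V` with its original one. -/
def ofEnergy (T : DiffusionOperator V H) : T.Energy ≃ₗ[ℝ] V where
  toFun v := v
  invFun v := v
  map_add' _ _ := rfl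
  map_smul' _ _ := rfl
  left_inv _ := rfl
  right_inv _ := rfl

theorem energy_inner (T : DiffusionOperator V H) (y z : T.Energy) :
    inner ℝ y z = T.A (T.ofEnergy y) (T.ofEnergy z) := rfl

theorem energy_norm_sq (T : DiffusionOperator V H) (y : T.Energy) :
    ‖y‖ ^ 2 = T.A (T.ofEnergy y) (T.ofEnergy y) := by
  rw [← real_inner_self_eq_norm_sq, energy_inner]

instance (T : DiffusionOperator V H) : CompleteSpace T.Energy := by
  apply Metric.complete_of_cauchySeq_tendsto
  intro u hu
  obtain ⟨v, hv⟩ := T.complete (fun n => T.ofEnergy (u n)) (by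
    intro ε hε
    obtain ⟨N, hN⟩ := Metric.cauchySeq_iff.1 hu (Real.sqrt ε) (Real.sqrt_pos.2 hε)
    refine ⟨N, fun m n hm hn => ?_⟩
    have h1 := hN m hm n hn
    rw [dist_eq_norm] at h1
    have h2 := T.energy_norm_sq (u m - u n)
    rw [map_sub] at h2
    rw [← h2]
    exact (Real.lt_sqrt (norm_nonneg _)).1 h1)
  refine ⟨T.ofEnergy.symm v, ?_⟩
  rw [tendsto_iff_norm_sub_tendsto_zero]
  have h3 : (fun n => ‖u n - T.ofEnergy.symm v‖)
      = fun n => Real.sqrt (T.A (T.ofEnergy (u n) - v) (T.ofEnergy (u n) - v)) := by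
    funext n
    rw [← Real.sqrt_sq (norm_nonneg (u n - T.ofEnergy.symm v)), T.energy_norm_sq, map_sub,
      LinearEquiv.apply_symm_apply]
  rw [h3]
  have h4 := (Real.continuous_sqrt.tendsto 0).comp hv
  rwa [Real.sqrt_zero] at h4

theorem continuous_ofEnergy_symm (T : DiffusionOperator V H) : Continuous T.ofEnergy.symm := by
  refine AddMonoidHomClass.continuous_of_bound T.ofEnergy.symm (Real.sqrt ‖T.A‖) fun v => ?_
  refine le_of_sq_le_sq ?_ (by positivity)
  rw [T.energy_norm_sq, LinearEquiv.apply_symm_apply, mul_pow,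
    Real.sq_sqrt (norm_nonneg T.A), sq, ← mul_assoc]
  exact (le_abs_self _).trans (T.A.le_opNorm₂ v v)

/-- The two norms of `V` are equivalent. -/
theorem continuous_ofEnergy (T : DiffusionOperator V H) : Continuous T.ofEnergy :=
  T.ofEnergy.symm.toContinuousLinearEquivOfContinuous T.continuous_ofEnergy_symm
    |>.symm.continuous

/-- The inclusion `V ⊆ H`, for the scalar product `⟨A y, z⟩` on `V`. -/
noncomputable def VtoH (T : DiffusionOperator V H) : T.Energy →L[ℝ] H :=
  T.incl.comp ⟨T.ofEnergy.toLinearMap, T.continuous_ofEnergy⟩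

/-- The dual `V'`, with the dual norm of `‖y‖_V = ⟨A y, y⟩^(1/2)`. -/
abbrev DualV (T : DiffusionOperator V H) : Type _ := StrongDual ℝ T.Energy

/-- The inclusion `H = H' ⊆ V'`, that is `⟨h, v⟩_{V',V} = (h, v)_H`. -/
noncomputable def HtoDualV (T : DiffusionOperator V H) : H →L[ℝ] T.DualV :=
  (ContinuousLinearMap.compL ℝ T.Energy H ℝ).flip T.VtoH ∘L innerSL ℝ

theorem HtoDualV_apply (T : DiffusionOperator V H) (h : H) (v : T.Energy) :
    T.HtoDualV h v = inner ℝ h (T.incl (T.ofEnergy v)) := rfl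

/-- The domain `{v ∈ V | A v ∈ H}` of `A` as an operator in `H`. -/
def domain (T : DiffusionOperator V H) : Submodule ℝ V where
  carrier := {v | ∃ h : H, ∀ w : V, T.A v w = inner ℝ h (T.incl w)}
  zero_mem' := ⟨0, by simp⟩
  add_mem' := by
    rintro a b ⟨h, hh⟩ ⟨k, hk⟩
    exact ⟨h + k, fun w => by simp [hh, hk, inner_add_left]⟩
  smul_mem' := by
    rintro c a ⟨h, hh⟩
    exact ⟨c • h, fun w => by simp [hh, real_inner_smul_left]⟩

/-- The domain `D(A)` as a space of its own; its norm is `‖A v‖_H`, see below. -/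
def Dom (T : DiffusionOperator V H) : Type _ := T.domain

instance (T : DiffusionOperator V H) : AddCommGroup T.Dom := inferInstanceAs (AddCommGroup T.domain)

instance (T : DiffusionOperator V H) : Module ℝ T.Dom := inferInstanceAs (Module ℝ T.domain)

/-- The inclusion `D(A) ⊆ V`, as a linear map. -/
def domVal (T : DiffusionOperator V H) : T.Dom →ₗ[ℝ] V := T.domain.subtype

theorem domVal_injective (T : DiffusionOperator V H) : Function.Injective T.domVal :=
  Subtype.val_injective

theorem exists_domA (T : DiffusionOperator V H) (v : T.Dom) :
    ∃ h : H, ∀ w : V, T.A (T.domVal v) w = inner ℝ h (T.incl w) := v.2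

theorem eq_of_inner_incl (T : DiffusionOperator V H) {h k : H}
    (e : ∀ w : V, inner ℝ h (T.incl w) = inner ℝ k (T.incl w)) : h = k :=
  T.incl_denseRange.eq_of_inner_left ℝ e

/-- The operator `A : D(A) → H`, characterised by `(A v, w)_H = ⟨A v, w⟩_{V',V}` for all `w ∈ V`. -/
noncomputable def domA (T : DiffusionOperator V H) : T.Dom →ₗ[ℝ] H where
  toFun v := (T.exists_domA v).choose
  map_add' u v := T.eq_of_inner_incl fun w => by
    rw [inner_add_left, ← (T.exists_domA (u + v)).choose_spec, ← (T.exists_domA u).choose_spec,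
      ← (T.exists_domA v).choose_spec]
    simp
  map_smul' c v := T.eq_of_inner_incl fun w => by
    rw [RingHom.id_apply, real_inner_smul_left, ← (T.exists_domA (c • v)).choose_spec,
      ← (T.exists_domA v).choose_spec]
    simp

theorem inner_domA (T : DiffusionOperator V H) (v : T.Dom) (w : V) :
    inner ℝ (T.domA v) (T.incl w) = T.A (T.domVal v) w := ((T.exists_domA v).choose_spec w).symm

theorem domA_injective (T : DiffusionOperator V H) : Function.Injective T.domA := by
  rw [injective_iff_map_eq_zero]
  intro v hv
  apply T.domVal_injective
  rw [map_zero]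
  by_contra hne
  have := T.pos _ hne
  rw [← T.inner_domA, hv, inner_zero_left] at this
  exact lt_irrefl _ this

theorem domA_surjective (T : DiffusionOperator V H) : Function.Surjective T.domA := by
  intro h
  let v : T.Energy := (InnerProductSpace.toDual ℝ T.Energy).symm (T.HtoDualV h)
  have hv : ∀ w : V, T.A (T.ofEnergy v) w = inner ℝ h (T.incl w) := fun w =>
    InnerProductSpace.toDual_symm_apply (𝕜 := ℝ) (x := T.ofEnergy.symm w) (y := T.HtoDualV h)
  refine ⟨(⟨T.ofEnergy v, h, hv⟩ : T.domain), T.eq_of_inner_incl fun w => ?_⟩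
  rw [← hv]
  exact T.inner_domA _ w

/-- `D(A)` is endowed with the norm `‖v‖_{D(A)} = ‖A v‖_H`. -/
noncomputable instance (T : DiffusionOperator V H) : NormedAddCommGroup T.Dom :=
  NormedAddCommGroup.induced T.Dom H T.domA T.domA_injective

noncomputable instance (T : DiffusionOperator V H) : NormedSpace ℝ T.Dom :=
  NormedSpace.induced ℝ T.Dom H T.domA

/-- The isometry `A : D(A) → H`; its inverse is `A⁻¹ : H → D(A)`. -/
noncomputable def domAEquiv (T : DiffusionOperator V H) : T.Dom ≃ₗᵢ[ℝ] H where
  toLinearEquiv := LinearEquiv.ofBijective T.domA ⟨T.domA_injective, T.domA_surjective⟩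
  norm_map' _ := rfl

theorem energy_norm_dom_le (T : DiffusionOperator V H) (v : T.Dom) :
    ‖T.ofEnergy.symm (T.domVal v)‖ ≤ ‖T.VtoH‖ * ‖v‖ := by
  have h1 := T.energy_norm_sq (T.ofEnergy.symm (T.domVal v))
  rw [LinearEquiv.apply_symm_apply, ← T.inner_domA] at h1
  have h2 := real_inner_le_norm (T.domA v) (T.incl (T.domVal v))
  have h3 : ‖T.incl (T.domVal v)‖ ≤ ‖T.VtoH‖ * ‖T.ofEnergy.symm (T.domVal v)‖ :=
    T.VtoH.le_opNorm (T.ofEnergy.symm (T.domVal v))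
  have h4 : ‖T.domA v‖ = ‖v‖ := rfl
  rw [h4] at h2
  set a := ‖T.ofEnergy.symm (T.domVal v)‖
  have ha : 0 ≤ a := norm_nonneg _
  have h5 : ‖v‖ * ‖T.incl (T.domVal v)‖ ≤ ‖v‖ * (‖T.VtoH‖ * a) :=
    mul_le_mul_of_nonneg_left h3 (norm_nonneg _)
  rcases ha.eq_or_lt with h0 | h0
  · rw [← h0]; positivity
  · refine le_of_mul_le_mul_right ?_ h0
    nlinarith

/-- The inclusion `D(A) ⊆ V`. -/
noncomputable def domToV (T : DiffusionOperator V H) : T.Dom →L[ℝ] T.Energy :=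
  (T.ofEnergy.symm.toLinearMap ∘ₗ T.domVal).mkContinuous ‖T.VtoH‖ T.energy_norm_dom_le

/-- The dual `D(A)'`, with the dual norm of `‖v‖_{D(A)} = ‖A v‖_H`. -/
abbrev DualDom (T : DiffusionOperator V H) : Type _ := StrongDual ℝ T.Dom

/-- The inclusion `V' ⊆ D(A)'`, that is `⟨f, v⟩_{D(A)',D(A)} = ⟨f, v⟩_{V',V}`. -/
noncomputable def dualVToDualDom (T : DiffusionOperator V H) : T.DualV →L[ℝ] T.DualDom :=
  (ContinuousLinearMap.compL ℝ T.Dom T.Energy ℝ).flip T.domToV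

/-- The inclusion `H ⊆ D(A)'`. -/
noncomputable def HtoDualDom (T : DiffusionOperator V H) : H →L[ℝ] T.DualDom :=
  T.dualVToDualDom ∘L T.HtoDualV

/-- The extension `A : H → D(A)'` of `A`, that is `⟨A h, v⟩_{D(A)',D(A)} = (h, A v)_H`. -/
noncomputable def AHtoDualDom (T : DiffusionOperator V H) : H →L[ℝ] T.DualDom :=
  (ContinuousLinearMap.compL ℝ T.Dom H ℝ).flip
    (T.domAEquiv.toContinuousLinearEquiv : T.Dom →L[ℝ] H) ∘L innerSL ℝ

/-- On `V`, the extension agrees with `A : V → V' ⊆ D(A)'`. -/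
theorem AHtoDualDom_incl (T : DiffusionOperator V H) (v : V) (w : T.Dom) :
    T.AHtoDualDom (T.incl v) w = T.A v (T.domVal w) := by
  rw [T.symm, ← T.inner_domA, real_inner_comm]
  rfl

/-- The Poincaré-type constant `ξ` of the functionals `d₁, …, dₙ ∈ D(A)'`: the infimum of
`‖Θ‖²_{D(A)} / ‖Θ‖²_V` over the `Θ ≠ 0` in `D(A)` that all `dⱼ` annihilate. -/
noncomputable def poincareConst (T : DiffusionOperator V H) {n : ℕ} (d : Fin n → T.DualDom) : ℝ :=
  ⨅ Θ : {Θ : T.Dom // (∀ j, d j Θ = 0) ∧ Θ ≠ 0}, ‖Θ.1‖ ^ 2 / ‖T.domToV Θ.1‖ ^ 2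

/-- The assumptions on the sequence `U_M = {d^{M,j} | 1 ≤ j ≤ σ(M)}`, `M ∈ ℕ₊`, of families of
actuators. -/
structure IsActuatorSequence (T : DiffusionOperator V H) (σ : ℕ+ → ℕ+)
    (d : (M : ℕ+) → Fin (σ M) → T.DualDom) : Prop where
  strictMono : StrictMono σ
  finrank_span : ∀ M, Module.finrank ℝ (Submodule.span ℝ (range (d M))) = σ M
  exists_auxiliary : ∃ Ψ : (M : ℕ+) → Fin (σ M) → T.Dom,
    (∀ M, Module.finrank ℝ (Submodule.span ℝ (range (Ψ M))) = σ M) ∧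
    ∀ M i j, d M j (Ψ M i) = if j = i then 1 else 0
  tendsto_poincareConst : Tendsto (fun M => T.poincareConst (d M)) atTop atTop

/-- `A_rc(t) ∈ L(H, V')`, `t > 0`, is (weakly) measurable in time, and its norm in
`L^∞((0,∞), L(H, V'))` is at most `C`. -/
structure IsReactionConvection (T : DiffusionOperator V H) (Arc : ℝ → H →L[ℝ] T.DualV) (C : ℝ) :
    Prop where
  aemeasurable : ∀ (h : H) (v : T.Energy),
    AEMeasurable (fun t => Arc t h v) (volume.restrict (Ioi 0))
  bound : ∀ᵐ t ∂(volume.restrict (Ioi (0 : ℝ))), ‖Arc t‖ ≤ C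

end DiffusionOperator

/-- `g` is the derivative of `f` in the sense of (vector-valued) distributions on the open set
`I ⊆ ℝ`. -/
def IsDistribDeriv {Y : Type*} [NormedAddCommGroup Y] [NormedSpace ℝ Y]
    (I : Set ℝ) (f g : ℝ → Y) : Prop :=
  ∀ φ : ℝ → ℝ, ContDiff ℝ ∞ φ → HasCompactSupport φ → tsupport φ ⊆ I →
    ∫ t in I, deriv φ t • f t = -∫ t in I, φ t • g t

/-- Membership of `f` in `W(I, X, Y) = {f ∈ L²(I, X) | f' ∈ L²(I, Y)}`, for `X ⊆ Y` with
inclusion `i`. -/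
def MemW {X Y : Type*} [NormedAddCommGroup X] [NormedSpace ℝ X] [NormedAddCommGroup Y]
    [NormedSpace ℝ Y] (i : X →L[ℝ] Y) (I : Set ℝ) (f : ℝ → X) : Prop :=
  MemLp f 2 (volume.restrict I) ∧
    ∃ g : ℝ → Y, MemLp g 2 (volume.restrict I) ∧ IsDistribDeriv I (fun t => i (f t)) g

namespace DiffusionOperator

variable {V H : Type*}
  [NormedAddCommGroup V] [InnerProductSpace ℝ V] [CompleteSpace V]
  [NormedAddCommGroup H] [InnerProductSpace ℝ H] [CompleteSpace H]

/-- `y` is a solution on `(0, ∞)` of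
`y' + A y + A_rc y = -λ ∑ⱼ ⟨dⱼ, A⁻¹ y⟩ dⱼ`, `y(0) = y₀ ∈ V'`.
It is in `W((0,τ), H, D(A)')` for all `τ > 0`, and the equation holds in `D(A)'` for almost every
time. The functions `y` and `yH` are two representatives of the same class: `y` is the continuous
`V'`-valued one, which gives the values `y(t) ∈ V'` at every time, and `yH` is an `H`-valued one. -/
structure IsSolution (T : DiffusionOperator V H) (Arc : ℝ → H →L[ℝ] T.DualV) (lam : ℝ)
    {n : ℕ} (d : Fin n → T.DualDom) (y₀ : T.DualV) (y : ℝ → T.DualV) (yH : ℝ → H) : Prop where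
  continuousOn : ContinuousOn y (Ici 0)
  initial : y 0 = y₀
  ae_eq : ∀ᵐ t ∂(volume.restrict (Ioi (0 : ℝ))), y t = T.HtoDualV (yH t)
  memLp : ∀ τ : ℝ, 0 < τ → MemLp yH 2 (volume.restrict (Ioo 0 τ))
  equation : ∃ y' : ℝ → T.DualDom,
    (∀ τ : ℝ, 0 < τ → MemLp y' 2 (volume.restrict (Ioo 0 τ))) ∧
    IsDistribDeriv (Ioi 0) (fun t => T.HtoDualDom (yH t)) y' ∧
    ∀ᵐ t ∂(volume.restrict (Ioi (0 : ℝ))),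
      y' t + T.AHtoDualDom (yH t) + T.dualVToDualDom (Arc t (yH t))
        = -(lam • ∑ j, d j (T.domAEquiv.symm (yH t)) • d j)

end DiffusionOperator

/-! The inverse `A⁻¹` turns the problem in `V'` into one in `V`: with `z = A⁻¹ y` seen in `V` and
`u = y` seen in `H`, one has `z = ι* u` for the inclusion `ι : V → H`, and the equation reads
`(ι z)' = -N(t) u` in `H`, where `N(t) = 1 + ι A⁻¹ A_rc(t) + λ ∑ⱼ (eⱼ, ·) eⱼ` and `eⱼ = A⁻¹ dⱼ`.

On the kernel of the actuators, `ξ` bounds `κ ‖ι* u‖²` by a fraction of `‖u‖²`; off the kernel, for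
`λ` large, the penalty does, because of the biorthogonal `Ψⱼ`. Hence
`(N(t) u, u) ≥ ¼ ‖u‖² + μ ‖ι* u‖²` when `κ = C² + μ`, and the energy identity
`d/dt ‖z‖² = 2 (u, (ι z)') = -2 (N(t) u, u)` yields uniqueness and both estimates. The identity is
proved mode by mode in a singular basis of `ι`. Existence on the half-line is Lions' representation
theorem for a variational formulation with the same coercivity.
-/

section Primitive

variable {F G : Type*} [NormedAddCommGroup F] [NormedSpace ℝ F]
  [NormedAddCommGroup G] [NormedSpace ℝ G]

/-- `f` is a primitive of `g` on `s ⊆ ℝ`: the fundamental theorem of calculus holds between any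
two points of `s`. The integrability is part of the notion, since the integral of a
nonintegrable function is `0` by convention. -/
def IsPrimitiveOn (s : Set ℝ) (f g : ℝ → F) : Prop :=
  ∀ a ∈ s, ∀ b ∈ s, IntervalIntegrable g volume a b ∧ ∫ r in a..b, g r = f b - f a

namespace IsPrimitiveOn

variable {s t : Set ℝ} {f f₁ f₂ g g₁ g₂ : ℝ → F}

theorem mono (h : IsPrimitiveOn s f g) (hts : t ⊆ s) : IsPrimitiveOn t f g :=
  fun a ha b hb => h a (hts ha) b (hts hb)

theorem sub (h₁ : IsPrimitiveOn s f₁ g₁) (h₂ : IsPrimitiveOn s f₂ g₂) :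
    IsPrimitiveOn s (fun t => f₁ t - f₂ t) (fun t => g₁ t - g₂ t) := fun a ha b hb => by
  obtain ⟨hi₁, he₁⟩ := h₁ a ha b hb
  obtain ⟨hi₂, he₂⟩ := h₂ a ha b hb
  refine ⟨hi₁.sub hi₂, ?_⟩
  rw [intervalIntegral.integral_sub hi₁ hi₂, he₁, he₂, sub_sub_sub_comm]

theorem congr (h : IsPrimitiveOn s f₁ g) (hf : EqOn f₁ f₂ s) : IsPrimitiveOn s f₂ g :=
  fun a ha b hb => by simpa only [hf ha, hf hb] using h a ha b hb

theorem congr_ae (h : IsPrimitiveOn s f g₁) (hs : s.OrdConnected)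
    (hg : g₁ =ᵐ[volume.restrict s] g₂) : IsPrimitiveOn s f g₂ := fun a ha b hb => by
  obtain ⟨hi, he⟩ := h a ha b hb
  have hab : g₁ =ᵐ[volume.restrict (uIoc a b)] g₂ :=
    ae_restrict_of_ae_restrict_of_subset (uIoc_subset_uIcc.trans (hs.uIcc_subset ha hb)) hg
  exact ⟨hi.congr_ae hab, by rw [← he, intervalIntegral.integral_congr_ae_restrict hab]⟩

theorem clm_comp [CompleteSpace F] [CompleteSpace G] (h : IsPrimitiveOn s f g) (L : F →L[ℝ] G) :
    IsPrimitiveOn s (fun t => L (f t)) (fun t => L (g t)) := fun a ha b hb => by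
  obtain ⟨hi, he⟩ := h a ha b hb
  refine ⟨⟨L.integrable_comp hi.1, L.integrable_comp hi.2⟩, ?_⟩
  rw [L.intervalIntegral_comp_comm hi, he, map_sub]

theorem of_hasDerivAt [CompleteSpace F] (hs : s.OrdConnected)
    (hf : ∀ x ∈ s, HasDerivAt f (g x) x) (hg : ContinuousOn g s) : IsPrimitiveOn s f g :=
  fun a ha b hb => by
    have hab : uIcc a b ⊆ s := hs.uIcc_subset ha hb
    have hi : IntervalIntegrable g volume a b := (hg.mono hab).intervalIntegrable
    exact ⟨hi, intervalIntegral.integral_eq_sub_of_hasDerivAt (fun x hx => hf x (hab hx)) hi⟩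

theorem of_integral {a : ℝ} (ha : a ∈ s) (c : F)
    (hg : ∀ x ∈ s, ∀ y ∈ s, IntervalIntegrable g volume x y) :
    IsPrimitiveOn s (fun t => c + ∫ r in a..t, g r) g := fun x hx y hy =>
  ⟨hg x hx y hy, by rw [add_sub_add_left_eq_sub,
    intervalIntegral.integral_interval_sub_left (hg a ha y hy) (hg a ha x hx)]⟩

theorem eqOn (h : IsPrimitiveOn s f g) {a : ℝ} (ha : a ∈ s) :
    EqOn f (fun t => f a + ∫ r in a..t, g r) s := fun t ht => by
  simp only [(h a ha t ht).2, add_sub_cancel]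

theorem continuousOn (h : IsPrimitiveOn s f g) (hs : s.OrdConnected) : ContinuousOn f s := by
  intro x hx
  obtain ⟨a, ha, hax⟩ : ∃ a ∈ s, Ici a ∈ 𝓝[s] x := by
    by_cases hl : ∃ a ∈ s, a < x
    · obtain ⟨a, ha, hax⟩ := hl
      exact ⟨a, ha, mem_nhdsWithin_of_mem_nhds (Ici_mem_nhds hax)⟩
    · push Not at hl
      exact ⟨x, hx, mem_of_superset self_mem_nhdsWithin hl⟩
  obtain ⟨b, hb, hbx⟩ : ∃ b ∈ s, Iic b ∈ 𝓝[s] x := by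
    by_cases hr : ∃ b ∈ s, x < b
    · obtain ⟨b, hb, hxb⟩ := hr
      exact ⟨b, hb, mem_nhdsWithin_of_mem_nhds (Iic_mem_nhds hxb)⟩
    · push Not at hr
      exact ⟨x, hx, mem_of_superset self_mem_nhdsWithin hr⟩
  have hI : uIcc a b ∈ 𝓝[s] x :=
    mem_of_superset (inter_mem hax hbx) (by rw [Ici_inter_Iic]; exact Icc_subset_uIcc)
  have hc : ContinuousOn f (uIcc a b) :=
    (continuousOn_const.add (intervalIntegral.continuousOn_primitive_interval'
      (h a ha b hb).1 left_mem_uIcc)).congr ((h.eqOn ha).mono (hs.uIcc_subset ha hb))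
  exact (hc x (mem_of_mem_nhdsWithin hx hI)).mono_of_mem_nhdsWithin hI

section Real

variable {f g p q : ℝ → ℝ}

theorem mul (hs : s.OrdConnected) (hf : IsPrimitiveOn s f p) (hg : IsPrimitiveOn s g q) :
    IsPrimitiveOn s (fun t => f t * g t) (fun t => p t * g t + f t * q t) := by
  intro a ha b hb
  have hab : uIcc a b ⊆ s := hs.uIcc_subset ha hb
  obtain ⟨hp, -⟩ := hf a ha b hb
  obtain ⟨hq, -⟩ := hg a ha b hb
  refine ⟨(hp.mul_continuousOn ((hg.continuousOn hs).mono hab)).add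
    (hq.continuousOn_mul ((hf.continuousOn hs).mono hab)), ?_⟩
  have ac : ∀ {p : ℝ → ℝ} (c : ℝ), IntervalIntegrable p volume a b →
      AbsolutelyContinuousOnInterval (fun t => c + ∫ r in a..t, p r) a b := fun c hp =>
    (LipschitzWith.const c).lipschitzOnWith.absolutelyContinuousOnInterval.fun_add
      (hp.absolutelyContinuousOnInterval_intervalIntegral left_mem_uIcc)
  have ae_deriv : ∀ {p : ℝ → ℝ} (c : ℝ), IntervalIntegrable p volume a b →
      ∀ᵐ x, x ∈ uIcc a b → deriv (fun t => c + ∫ r in a..t, p r) x = p x := fun c hp => by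
    filter_upwards [hp.ae_hasDerivAt_integral] with x hx hxab
    exact ((hx hxab a left_mem_uIcc).const_add c).deriv
  convert! (ac (f a) hp).integral_deriv_mul_eq_sub (ac (g a) hq) using 1
  · refine intervalIntegral.integral_congr_ae ?_
    filter_upwards [ae_deriv (f a) hp, ae_deriv (g a) hq] with x hpx hqx hx
    have hx : x ∈ uIcc a b := uIoc_subset_uIcc hx
    rw [hpx hx, hqx hx, hf.eqOn ha (hab hx), hg.eqOn ha (hab hx)]
  · simp only [hf.eqOn ha hb, hg.eqOn ha hb, intervalIntegral.integral_same, add_zero]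

theorem le_exp_mul {a b k : ℝ} (hf : IsPrimitiveOn (Icc a b) f p) (hab : a ≤ b)
    (hle : ∀ᵐ t ∂volume.restrict (Ioc a b), p t ≤ -k * f t) :
    f b ≤ Real.exp (-(k * (b - a))) * f a := by
  have hexp : IsPrimitiveOn (Icc a b) (fun t => Real.exp (k * t))
      (fun t => k * Real.exp (k * t)) :=
    of_hasDerivAt ordConnected_Icc
      (fun t _ => by simpa [mul_comm] using ((hasDerivAt_id t).const_mul k).exp) (by fun_prop)
  have hincr := (hf.mul ordConnected_Icc hexp a (left_mem_Icc.2 hab) b (right_mem_Icc.2 hab)).2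
  have hdecr : ∫ t in a..b, p t * Real.exp (k * t) + f t * (k * Real.exp (k * t)) ≤ 0 := by
    rw [intervalIntegral.integral_of_le hab]
    refine integral_nonpos_of_ae ?_
    filter_upwards [hle] with t ht
    have := mul_le_mul_of_nonneg_right ht (Real.exp_pos (k * t)).le
    simp only [Pi.zero_apply]
    linarith
  have hfac : Real.exp (-(k * (b - a))) = Real.exp (k * a) / Real.exp (k * b) := by
    rw [← Real.exp_sub]
    ring_nf
  rw [hfac, div_mul_eq_mul_div, le_div_iff₀ (Real.exp_pos _)]
  linarith

end Real

theorem smul [CompleteSpace F] {φ p : ℝ → ℝ} (hs : s.OrdConnected) (hφ : IsPrimitiveOn s φ p)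
    (hf : IsPrimitiveOn s f g) :
    IsPrimitiveOn s (fun t => φ t • f t) (fun t => p t • f t + φ t • g t) := by
  intro a ha b hb
  have hab : uIcc a b ⊆ s := hs.uIcc_subset ha hb
  have hi : IntervalIntegrable (fun t => p t • f t + φ t • g t) volume a b :=
    ((hφ a ha b hb).1.smul_continuousOn ((hf.continuousOn hs).mono hab)).add
      ((hf a ha b hb).1.continuousOn_smul ((hφ.continuousOn hs).mono hab))
  refine ⟨hi, (SeparatingDual.eq_iff_forall_dual_eq (R := ℝ)).2 fun L => ?_⟩
  have hL := (hφ.mul hs (hf.clm_comp L) a ha b hb).2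
  simpa only [← L.intervalIntegral_comp_comm hi, map_add, map_sub, map_smul, smul_eq_mul] using hL

end IsPrimitiveOn

end Primitive

section Distribution

variable {F G : Type*} [NormedAddCommGroup F] [NormedSpace ℝ F]
  [NormedAddCommGroup G] [NormedSpace ℝ G] {I : Set ℝ} {f f₁ f₂ g g₁ g₂ w : ℝ → F}

theorem exists_Icc_subset_of_isCompact_of_isOpen [hI : I.OrdConnected] (hIo : IsOpen I)
    (hne : I.Nonempty) {K : Set ℝ} (hK : IsCompact K) (hKI : K ⊆ I) :
    ∃ a b, a ≤ b ∧ Icc a b ⊆ I ∧ K ⊆ Ioo a b := by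
  rcases K.eq_empty_or_nonempty with rfl | hKne
  · obtain ⟨x, hx⟩ := hne
    exact ⟨x, x, le_rfl, by simpa using hx, empty_subset _⟩
  obtain ⟨m, hm, hmK⟩ := hK.exists_isLeast hKne
  obtain ⟨M, hM, hKM⟩ := hK.exists_isGreatest hKne
  obtain ⟨a, ham, haI⟩ := exists_Ioc_subset_of_mem_nhds (hIo.mem_nhds (hKI hm)) (exists_lt m)
  obtain ⟨b, hMb, hbI⟩ := exists_Ico_subset_of_mem_nhds (hIo.mem_nhds (hKI hM)) (exists_gt M)
  obtain ⟨a', haa', ha'm⟩ := exists_between ham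
  obtain ⟨b', hMb', hb'b⟩ := exists_between hMb
  exact ⟨a', b', (ha'm.trans_le (hmK hM)).le.trans hMb'.le,
    hI.out (haI ⟨haa', ha'm.le⟩) (hbI ⟨hMb'.le, hb'b⟩),
    fun x hx => ⟨ha'm.trans_le (hmK hx), (hKM hx).trans_lt hMb'⟩⟩

theorem setIntegral_eq_intervalIntegral_of_support_subset {a b : ℝ}
    (hI : Icc a b ⊆ I) (hf : Function.support f ⊆ Ioo a b) :
    ∫ t in I, f t = ∫ t in a..b, f t := by
  rw [intervalIntegral.integral_eq_integral_of_support_subset (hf.trans Ioo_subset_Ioc_self)]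
  exact setIntegral_eq_integral_of_forall_compl_eq_zero fun t ht =>
    Function.notMem_support.1 fun h => ht (hI (Ioo_subset_Icc_self (hf h)))

theorem IsPrimitiveOn.isDistribDeriv [CompleteSpace F] [I.OrdConnected] (hIo : IsOpen I)
    (h : IsPrimitiveOn I f g) : IsDistribDeriv I f g := by
  intro φ hφ hφc hφI
  rcases I.eq_empty_or_nonempty with rfl | hne
  · simp
  obtain ⟨a, b, hab, habI, hsub⟩ :=
    exists_Icc_subset_of_isCompact_of_isOpen hIo hne hφc.isCompact hφI
  have hzero : ∀ t ∉ Ioo a b, φ t = 0 := fun t ht =>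
    image_eq_zero_of_notMem_tsupport fun h => ht (hsub h)
  have hφ' : Continuous (deriv φ) := hφ.continuous_deriv (by simp)
  have hab' : IsPrimitiveOn (Icc a b) f g := h.mono habI
  have ha := left_mem_Icc.2 hab
  have hb := right_mem_Icc.2 hab
  have hparts := (IsPrimitiveOn.smul ordConnected_Icc (.of_hasDerivAt ordConnected_Icc
    (fun t _ => (hφ.differentiable (by simp) t).hasDerivAt) hφ'.continuousOn) hab' a ha b hb).2
  beta_reduce at hparts
  rw [hzero a (by simp), hzero b (by simp), zero_smul, zero_smul, sub_zero,
    intervalIntegral.integral_add] at hparts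
  · rw [setIntegral_eq_intervalIntegral_of_support_subset habI,
      setIntegral_eq_intervalIntegral_of_support_subset habI]
    · exact eq_neg_of_add_eq_zero_left hparts
    · exact (Function.support_smul_subset_left _ _).trans ((subset_tsupport _).trans hsub)
    · exact (Function.support_smul_subset_left _ _).trans
        ((subset_tsupport _).trans (tsupport_deriv_subset.trans hsub))
  · exact (hφ'.intervalIntegrable a b).smul_continuousOn
      ((h.continuousOn ‹_›).mono (uIcc_of_le hab ▸ habI))
  · exact (hab' a ha b hb).1.continuousOn_smul hφ.continuous.continuousOn

theorem integrableOn_smul_of_tsupport_subset {η : ℝ → ℝ} (hη : Continuous η)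
    (hηc : HasCompactSupport η) (hηI : tsupport η ⊆ I) (hI : MeasurableSet I)
    (hf : LocallyIntegrableOn f I) : IntegrableOn (fun t => η t • f t) I := by
  refine ((hf.integrableOn_compact_subset hηI hηc.isCompact).continuousOn_smul hη.continuousOn
    hηc.isCompact).of_forall_sdiff_eq_zero hI fun t ht => ?_
  rw [image_eq_zero_of_notMem_tsupport ht.2, zero_smul]

theorem exists_contDiff_primitive_of_integral_eq_zero [I.OrdConnected] (hIo : IsOpen I)
    (hne : I.Nonempty) {η : ℝ → ℝ} (hη : ContDiff ℝ ∞ η) (hηc : HasCompactSupport η)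
    (hηI : tsupport η ⊆ I) (h0 : ∫ t, η t = 0) :
    ∃ φ : ℝ → ℝ, ContDiff ℝ ∞ φ ∧ HasCompactSupport φ ∧ tsupport φ ⊆ I ∧ deriv φ = η := by
  obtain ⟨a, b, -, habI, hsub⟩ :=
    exists_Icc_subset_of_isCompact_of_isOpen hIo hne hηc.isCompact hηI
  have hderiv : ∀ t, HasDerivAt (fun t => ∫ r in a..t, η r) (η t) t := fun t =>
    intervalIntegral.integral_hasDerivAt_right (hη.continuous.intervalIntegrable _ _)
      (hη.continuous.stronglyMeasurableAtFilter _ _) hη.continuous.continuousAt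
  have hsupp : ∀ t ∉ Icc a b, ∫ r in a..t, η r = 0 := by
    intro t ht
    rcases lt_or_ge t a with hta | hat
    · rw [intervalIntegral.integral_congr (g := fun _ => (0 : ℝ)) fun x hx => ?_,
        intervalIntegral.integral_zero]
      rw [uIcc_of_ge hta.le] at hx
      exact image_eq_zero_of_notMem_tsupport fun h => (hsub h).1.not_ge hx.2
    · have hbt : b < t := not_le.1 fun htb => ht ⟨hat, htb⟩
      rw [intervalIntegral.integral_eq_integral_of_support_subset, h0]
      exact (subset_tsupport η).trans fun x hx => ⟨(hsub hx).1, (hsub hx).2.le.trans hbt.le⟩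
  have hts : tsupport (fun t => ∫ r in a..t, η r) ⊆ Icc a b :=
    closure_minimal (fun t ht => by_contra fun h => ht (hsupp t h)) isClosed_Icc
  have hφ' : deriv (fun t => ∫ r in a..t, η r) = η := funext fun t => (hderiv t).deriv
  exact ⟨_, contDiff_infty_iff_deriv.2 ⟨fun t => (hderiv t).differentiableAt, by rwa [hφ']⟩,
    .intro isCompact_Icc hsupp, hts.trans habI, hφ'⟩

theorem exists_contDiff_tsupport_subset_integral_eq_one (hIo : IsOpen I) (hne : I.Nonempty) :
    ∃ ρ : ℝ → ℝ, ContDiff ℝ ∞ ρ ∧ HasCompactSupport ρ ∧ tsupport ρ ⊆ I ∧ ∫ t, ρ t = 1 := by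
  obtain ⟨x, hx⟩ := hne
  obtain ⟨r, hr, hrI⟩ := Metric.nhds_basis_closedBall.mem_iff.1 (hIo.mem_nhds hx)
  let χ : ContDiffBump x := ⟨r / 2, r, by linarith, by linarith⟩
  exact ⟨χ.normed volume, χ.contDiff_normed, χ.hasCompactSupport_normed,
    χ.tsupport_normed_eq.trans_subset hrI, χ.integral_normed⟩

namespace IsDistribDeriv

theorem congr_left (h : IsDistribDeriv I f₁ g) (hf : f₁ =ᵐ[volume.restrict I] f₂) :
    IsDistribDeriv I f₂ g := fun φ hφ hφc hφI => by
  rw [← h φ hφ hφc hφI]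
  refine integral_congr_ae ?_
  filter_upwards [hf] with t ht
  rw [ht]

theorem map (h : IsDistribDeriv I f g) (L : F ≃L[ℝ] G) :
    IsDistribDeriv I (fun t => L (f t)) (fun t => L (g t)) := fun φ hφ hφc hφI => by
  have := congrArg L (h φ hφ hφc hφI)
  rw [map_neg, ← L.integral_comp_comm, ← L.integral_comp_comm] at this
  simpa only [map_smul] using this

theorem sub (h₁ : IsDistribDeriv I f₁ g) (h₂ : IsDistribDeriv I f₂ g) (hI : MeasurableSet I)
    (hf₁ : LocallyIntegrableOn f₁ I) (hf₂ : LocallyIntegrableOn f₂ I) :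
    IsDistribDeriv I (fun t => f₁ t - f₂ t) 0 := fun φ hφ hφc hφI => by
  have hφ' : Continuous (deriv φ) := hφ.continuous_deriv (by simp)
  have hi : ∀ {f : ℝ → F}, LocallyIntegrableOn f I → IntegrableOn (fun t => deriv φ t • f t) I :=
    integrableOn_smul_of_tsupport_subset hφ' hφc.deriv (tsupport_deriv_subset.trans hφI) hI
  simp only [smul_sub, Pi.zero_apply, smul_zero, integral_zero, neg_zero]
  rw [integral_sub (hi hf₁) (hi hf₂), h₁ φ hφ hφc hφI, h₂ φ hφ hφc hφI, sub_self]

theorem setIntegral_smul_eq_integral_smul [I.OrdConnected] (h : IsDistribDeriv I f 0)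
    (hIo : IsOpen I) (hne : I.Nonempty) (hf : LocallyIntegrableOn f I) {η ρ : ℝ → ℝ}
    (hη : ContDiff ℝ ∞ η) (hηc : HasCompactSupport η) (hηI : tsupport η ⊆ I)
    (hρ : ContDiff ℝ ∞ ρ) (hρc : HasCompactSupport ρ) (hρI : tsupport ρ ⊆ I)
    (hρ1 : ∫ t, ρ t = 1) :
    ∫ t in I, η t • f t = (∫ t, η t) • ∫ t in I, ρ t • f t := by
  set k := ∫ t, η t
  -- `η - k ρ` has integral zero, so it is the derivative of a test function
  obtain ⟨φ, hφ, hφc, hφI, hφ'⟩ := exists_contDiff_primitive_of_integral_eq_zero hIo hne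
    (hη.sub (contDiff_const.mul hρ)) (hηc.sub (hρc.mul_left (f := fun _ => k)))
    ((tsupport_sub _ _).trans (union_subset hηI (tsupport_mul_subset_right.trans hρI)))
    (by
      rw [integral_sub (hη.continuous.integrable_of_hasCompactSupport hηc)
        ((hρ.continuous.integrable_of_hasCompactSupport hρc).const_mul k), integral_const_mul,
        hρ1, mul_one, sub_self])
  have hzero := h φ hφ hφc hφI
  simp only [hφ', sub_smul, mul_smul, Pi.zero_apply, smul_zero,
    integral_zero, neg_zero] at hzero
  rw [integral_sub, integral_smul] at hzero
  · exact sub_eq_zero.1 hzero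
  · exact integrableOn_smul_of_tsupport_subset hη.continuous hηc hηI hIo.measurableSet hf
  · exact (integrableOn_smul_of_tsupport_subset hρ.continuous hρc hρI hIo.measurableSet hf).smul k

/-- The lemma of du Bois-Reymond. -/
theorem exists_ae_eq_const [CompleteSpace F] [I.OrdConnected] (h : IsDistribDeriv I f 0)
    (hIo : IsOpen I) (hf : LocallyIntegrableOn f I) :
    ∃ c, ∀ᵐ t ∂volume.restrict I, f t = c := by
  rcases I.eq_empty_or_nonempty with rfl | hne
  · exact ⟨0, by simp⟩
  obtain ⟨ρ, hρ, hρc, hρI, hρ1⟩ := exists_contDiff_tsupport_subset_integral_eq_one hIo hne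
  set c := ∫ t in I, ρ t • f t
  have hfc : ∀ᵐ t, t ∈ I → f t - c = 0 := by
    refine hIo.ae_eq_zero_of_integral_contDiff_smul_eq_zero
      (hf.sub (locallyIntegrableOn_const c)) fun η hη hηc hηI => ?_
    have hηi : Integrable η := hη.continuous.integrable_of_hasCompactSupport hηc
    rw [← setIntegral_eq_integral_of_forall_compl_eq_zero (s := I) fun t ht => by
      rw [image_eq_zero_of_notMem_tsupport fun h => ht (hηI h), zero_smul]]
    simp only [smul_sub]
    rw [integral_sub (integrableOn_smul_of_tsupport_subset hη.continuous hηc hηI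
        hIo.measurableSet hf) (hηi.smul_const c).integrableOn, integral_smul_const,
      h.setIntegral_smul_eq_integral_smul hIo hne hf hη hηc hηI hρ hρc hρI hρ1,
      setIntegral_eq_integral_of_forall_compl_eq_zero fun t ht =>
        image_eq_zero_of_notMem_tsupport fun h => ht (hηI h), sub_self]
  refine ⟨c, (ae_restrict_iff' hIo.measurableSet).2 ?_⟩
  filter_upwards [hfc] with t ht htI using sub_eq_zero.1 (ht htI)

theorem exists_ae_sub_eq_const [CompleteSpace F] [I.OrdConnected] (h : IsDistribDeriv I f g)
    (hIo : IsOpen I) (hf : LocallyIntegrableOn f I) (hw : IsPrimitiveOn I w g) :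
    ∃ c, ∀ᵐ t ∂volume.restrict I, f t - w t = c := by
  have hwl : LocallyIntegrableOn w I :=
    (hw.continuousOn ‹_›).locallyIntegrableOn hIo.measurableSet
  exact (h.sub (hw.isDistribDeriv hIo) hIo.measurableSet hf hwl).exists_ae_eq_const hIo
    (hf.sub hwl)

theorem isPrimitiveOn_Ici [CompleteSpace F] {a : ℝ} (h : IsDistribDeriv (Ioi a) f g)
    (hf : ContinuousOn f (Ici a)) (hg : ∀ x ∈ Ici a, ∀ y ∈ Ici a, IntervalIntegrable g volume x y) :
    IsPrimitiveOn (Ici a) f g := by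
  have hw : IsPrimitiveOn (Ici a) (fun t => 0 + ∫ r in a..t, g r) g :=
    .of_integral self_mem_Ici 0 hg
  obtain ⟨c, hc⟩ := h.exists_ae_sub_eq_const isOpen_Ioi
    ((hf.mono Ioi_subset_Ici_self).locallyIntegrableOn measurableSet_Ioi)
    (hw.mono Ioi_subset_Ici_self)
  rw [restrict_Ioi_eq_restrict_Ici] at hc
  have hfw : EqOn (fun t => f t - (0 + ∫ r in a..t, g r)) (fun _ => c) (Ici a) :=
    Measure.eqOn_of_ae_eq hc (hf.sub (hw.continuousOn ordConnected_Ici)) continuousOn_const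
      (by simp)
  intro x hx y hy
  obtain ⟨hi, he⟩ := hw x hx y hy
  exact ⟨hi, he.trans (sub_eq_sub_iff_sub_eq_sub.2 ((hfw hy).trans (hfw hx).symm)).symm⟩

end IsDistribDeriv

end Distribution

section Hilbert

open TopologicalSpace (SeparableSpace)

variable {F : Type*} [NormedAddCommGroup F] [InnerProductSpace ℝ F] {I : Type*}

/-- Lions' representation theorem. -/
theorem exists_inner_eq_of_abs_le_mul_norm [CompleteSpace F] {Φ : Type*} [AddCommGroup Φ]
    [Module ℝ Φ] (K : Φ →ₗ[ℝ] F) (L : Φ →ₗ[ℝ] ℝ) (c : ℝ) (h : ∀ φ, |L φ| ≤ c * ‖K φ‖) :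
    ∃ u : F, ∀ φ, inner ℝ u (K φ) = L φ := by
  -- `L` factors through `K`, by a functional which is bounded on the range of `K`
  have hker : LinearMap.ker K ≤ LinearMap.ker L := fun φ hφ => by
    simpa [LinearMap.mem_ker.1 hφ] using h φ
  let ℓ : LinearMap.range K →ₗ[ℝ] ℝ :=
    (LinearMap.ker K).liftQ L hker ∘ₗ K.quotKerEquivRange.symm.toLinearMap
  have hℓ : ∀ φ, ℓ (K.rangeRestrict φ) = L φ := fun φ =>
    congrArg ((LinearMap.ker K).liftQ L hker) (K.quotKerEquivRange_symm_apply_image φ _)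
  have hbound : ∀ x, ‖ℓ x‖ ≤ c * ‖x‖ := fun x => by
    obtain ⟨φ, rfl⟩ := K.surjective_rangeRestrict x
    rw [hℓ]
    exact h φ
  obtain ⟨g, hg, -⟩ := exists_extension_norm_eq _ (ℓ.mkContinuous c hbound)
  refine ⟨(InnerProductSpace.toDual ℝ F).symm g, fun φ => ?_⟩
  rw [InnerProductSpace.toDual_symm_apply, ← hℓ]
  exact hg (K.rangeRestrict φ)

variable (e : HilbertBasis I ℝ F)

theorem countable_of_orthonormal [SeparableSpace F] {v : I → F} (hv : Orthonormal ℝ v) :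
    Countable I := by
  refine Pairwise.countable_of_isOpen_disjoint (s := fun i => Metric.ball (v i) (1 / 2))
    (fun i k hik => Metric.ball_disjoint_ball ?_)
    (fun _ => Metric.isOpen_ball) fun i => ⟨v i, Metric.mem_ball_self (by norm_num)⟩
  have h : ‖v i - v k‖ ^ 2 = 2 := by
    rw [norm_sub_sq_real, hv.1, hv.1, hv.2 hik]
    norm_num
  rw [dist_eq_norm]
  nlinarith [norm_nonneg (v i - v k)]

theorem eq_of_forall_inner_eq {x y : F} (h : ∀ i, inner ℝ (e i) x = inner ℝ (e i) y) : x = y :=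
  e.repr.injective (lp.ext (funext fun i => by simpa only [e.repr_apply_apply] using h i))

theorem hasSum_inner_sq (x : F) : HasSum (fun i => inner ℝ (e i) x ^ 2) (‖x‖ ^ 2) := by
  simpa only [real_inner_self_eq_norm_sq, real_inner_comm, sq] using e.hasSum_inner_mul_inner x x

theorem aestronglyMeasurable_of_forall_inner [CompleteSpace F] [SeparableSpace F] {α : Type*}
    [MeasurableSpace α] {m : Measure α} {f : α → F}
    (hf : ∀ x, AEMeasurable (fun t => inner ℝ (f t) x) m) : AEStronglyMeasurable f m := by
  obtain ⟨w, e, -⟩ := exists_hilbertBasis ℝ F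
  have : Countable w := countable_of_orthonormal e.orthonormal
  refine aestronglyMeasurable_of_tendsto_ae (atTop : Filter (Finset w))
    (f := fun s t => ∑ i ∈ s, inner ℝ (f t) (e i) • e i)
    (fun s => Finset.aestronglyMeasurable_fun_sum _ fun i _ =>
      (hf (e i)).aestronglyMeasurable.smul_const _) (.of_forall fun t => ?_)
  have hsum : HasSum (fun i => inner ℝ (f t) (e i) • e i) (f t) := by
    simpa only [e.repr_apply_apply, real_inner_comm] using e.hasSum_repr (f t)
  exact hsum

theorem integrable_inner_of_memLp {α : Type*} [MeasurableSpace α] {m : Measure α} {u g : α → F}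
    (hu : MemLp u 2 m) (hg : MemLp g 2 m) : Integrable (fun t => inner ℝ (u t) (g t)) m :=
  (hu.norm.integrable_mul hg.norm).mono' (hu.1.inner hg.1)
    (.of_forall fun t => norm_inner_le_norm (u t) (g t))

theorem hasSum_integral_inner_mul_inner [Countable I] {α : Type*} [MeasurableSpace α]
    {m : Measure α} {u g : α → F} (hu : MemLp u 2 m) (hg : MemLp g 2 m) :
    HasSum (fun i => ∫ t, inner ℝ (e i) (u t) * inner ℝ (e i) (g t) ∂m)
      (∫ t, inner ℝ (u t) (g t) ∂m) := by
  have hsum : ∀ t, HasSum (fun i => inner ℝ (e i) (u t) ^ 2 + inner ℝ (e i) (g t) ^ 2)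
      (‖u t‖ ^ 2 + ‖g t‖ ^ 2) := fun t => (hasSum_inner_sq e _).add (hasSum_inner_sq e _)
  refine hasSum_integral_of_dominated_convergence
    (fun i t => inner ℝ (e i) (u t) ^ 2 + inner ℝ (e i) (g t) ^ 2)
    (fun i => (hu.1.const_inner (c := e i)).mul (hg.1.const_inner (c := e i)))
    (fun i => .of_forall fun t => ?_) (.of_forall fun t => (hsum t).summable) ?_
    (.of_forall fun t => ?_)
  · rw [Real.norm_eq_abs, abs_le]
    constructor <;> nlinarith [sq_nonneg (inner ℝ (e i) (u t) + inner ℝ (e i) (g t)),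
      sq_nonneg (inner ℝ (e i) (u t) - inner ℝ (e i) (g t))]
  · simp only [(hsum _).tsum_eq]
    exact hu.norm.integrable_sq.add hg.norm.integrable_sq
  · simpa only [real_inner_comm] using e.hasSum_inner_mul_inner (u t) (g t)

theorem exists_continuous_of_coordinates {X : Type*} [TopologicalSpace X] {c : I → X → ℝ}
    {B : I → ℝ} (hc : ∀ i, Continuous (c i)) (hB : Summable B) (hcB : ∀ i x, c i x ^ 2 ≤ B i) :
    ∃ z : X → F, Continuous z ∧ ∀ i x, inner ℝ (e i) (z x) = c i x := by
  have hmem : ∀ x, Memℓp (fun i => c i x) 2 := fun x =>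
    memℓp_gen (hB.of_nonneg_of_le (fun i => by positivity) fun i => by simpa using hcB i x)
  let z : X → F := fun x => e.repr.symm ⟨fun i => c i x, hmem x⟩
  have hz : ∀ i x, inner ℝ (e i) (z x) = c i x := fun i x => by
    rw [← e.repr_apply_apply, LinearIsometryEquiv.apply_symm_apply]
  refine ⟨z, continuous_iff_continuousAt.2 fun x => ?_, hz⟩
  have hnorm : ∀ y, ‖z y - z x‖ ^ 2 = ∑' i, (c i y - c i x) ^ 2 := fun y => by
    simpa only [inner_sub_right, hz] using (hasSum_inner_sq e (z y - z x)).tsum_eq.symm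
  have hlim : Tendsto (fun y => ∑' i, (c i y - c i x) ^ 2) (𝓝 x) (𝓝 (∑' _ : I, (0 : ℝ))) := by
    refine tendsto_tsum_of_dominated_convergence (bound := fun i => 4 * B i) (hB.mul_left 4)
      (fun i => ?_) (.of_forall fun y i => ?_)
    · have := (((hc i).sub (continuous_const (y := c i x))).pow 2).tendsto x
      simpa [Pi.pow_def, Pi.sub_def] using this
    · rw [Real.norm_of_nonneg (by positivity)]
      nlinarith [hcB i x, hcB i y, sq_nonneg (c i y + c i x)]
  simp only [← hnorm, tsum_zero] at hlim
  rw [ContinuousAt, tendsto_iff_norm_sub_tendsto_zero]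
  simpa [Function.comp_def, Real.sqrt_sq (norm_nonneg _)] using
    (Real.continuous_sqrt.tendsto 0).comp hlim

theorem exists_hilbertBasis_of_orthogonalFamily [CompleteSpace F] {κ : Type*}
    {G : κ → Submodule ℝ F} [∀ k, CompleteSpace (G k)]
    (hG : OrthogonalFamily ℝ (fun k => G k) fun k => (G k).subtypeₗᵢ) (htop : (⨆ k, G k)ᗮ = ⊥) :
    ∃ (w : (k : κ) → Set (G k)) (e : HilbertBasis (Σ k, w k) ℝ F), ∀ i, e i ∈ G i.1 := by
  choose w B _ using fun k => exists_hilbertBasis ℝ (G k)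
  have hon := hG.orthonormal_sigma_orthonormal fun k => (B k).orthonormal
  refine ⟨w, .mkOfOrthogonalEqBot hon ((Submodule.eq_bot_iff _).2 fun x hx => ?_), fun i => ?_⟩
  · rw [← Submodule.mem_bot ℝ, ← htop, ← Submodule.iInf_orthogonal, Submodule.mem_iInf]
    intro k
    rw [← Submodule.orthogonalProjectionOnto_eq_zero_iff]
    refine eq_of_forall_inner_eq (B k) fun j => ?_
    rw [Submodule.inner_orthogonalProjectionOnto_eq_of_mem_left, inner_zero_right]
    exact hx _ (Submodule.subset_span ⟨⟨k, j⟩, rfl⟩)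
  · rw [HilbertBasis.coe_mkOfOrthogonalEqBot]
    exact (B i.1 i.2).2

end Hilbert

section SingularBasis

open ContinuousLinearMap (adjoint adjoint_inner_left adjoint_inner_right)
open TopologicalSpace (SeparableSpace IsSeparable isSeparable_univ_iff)

variable {E H : Type*} [NormedAddCommGroup E] [InnerProductSpace ℝ E]
  [NormedAddCommGroup H] [InnerProductSpace ℝ H]

theorem separableSpace_of_isCompactOperator {ι : E →L[ℝ] H} (hc : IsCompactOperator ι)
    (hd : DenseRange ι) : SeparableSpace H := by
  have hrange : range ι = ⋃ n : ℕ, ι '' Metric.closedBall 0 n := by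
    rw [← image_iUnion, Metric.iUnion_closedBall_nat, image_univ]
  have hsep : IsSeparable (range ι) := by
    rw [hrange]
    refine .iUnion fun n => ?_
    obtain ⟨K, hK, hnK⟩ := hc.image_closedBall_subset_compact (f := ι.toLinearMap) n
    exact hK.isSeparable.mono hnK
  exact isSeparable_univ_iff.1 (hd.closure_range ▸ hsep.closure)

variable [CompleteSpace E] [CompleteSpace H]

theorem adjoint_injective_of_denseRange {ι : E →L[ℝ] H} (hd : DenseRange ι) :
    Function.Injective (adjoint ι) :=
  (injective_iff_map_eq_zero _).2 fun h hh => hd.eq_zero_of_inner_left ℝ fun v => by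
    rw [← adjoint_inner_left, hh, inner_zero_left]

theorem exists_hilbertBasis_eigenvectors {S : H →L[ℝ] H} (hSc : IsCompactOperator S)
    (hSs : (S : H →ₗ[ℝ] H).IsSymmetric) :
    ∃ (w : (μ : ℝ) → Set (Module.End.eigenspace (S : Module.End ℝ H) μ))
      (e : HilbertBasis (Σ μ, w μ) ℝ H), ∀ i, S (e i) = i.1 • e i := by
  have : ∀ μ, CompleteSpace (Module.End.eigenspace (S : Module.End ℝ H) μ) := fun μ => by
    have heq : (Module.End.eigenspace (S : Module.End ℝ H) μ : Set H) = {x | S x = μ • x} := by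
      ext x
      simp
    exact (heq ▸ isClosed_eq S.continuous (continuous_const_smul μ)).completeSpace_coe
  obtain ⟨w, e, he⟩ := exists_hilbertBasis_of_orthogonalFamily
    hSs.orthogonalFamily_eigenspaces (S.orthogonalComplement_iSup_eigenspaces_eq_bot hSc hSs)
  exact ⟨w, e, fun i => Module.End.mem_eigenspace_iff.1 (he i)⟩

/-- A singular value decomposition of `ι : E → H` whose singular values are all positive:
orthonormal bases `b` of `E` and `e` of `H` such that `ι* eᵢ = sᵢ bᵢ`. -/
structure SingularBasis (ι : E →L[ℝ] H) (I : Type*) where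
  b : HilbertBasis I ℝ E
  e : HilbertBasis I ℝ H
  s : I → ℝ
  pos : ∀ i, 0 < s i
  adjoint_apply : ∀ i, adjoint ι (e i) = s i • b i

namespace SingularBasis

variable {ι : E →L[ℝ] H} {I : Type*} (B : SingularBasis ι I)
include B

theorem inner_map (i : I) (z : E) : inner ℝ (B.e i) (ι z) = B.s i * inner ℝ (B.b i) z := by
  rw [← adjoint_inner_left, B.adjoint_apply, real_inner_smul_left]

theorem map_apply (i : I) : ι (B.b i) = B.s i • B.e i := by
  classical
  refine eq_of_forall_inner_eq B.e fun k => ?_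
  rw [B.inner_map, real_inner_smul_right, orthonormal_iff_ite.1 B.e.orthonormal,
    orthonormal_iff_ite.1 B.b.orthonormal]
  by_cases hki : k = i <;> simp [hki]

theorem inner_adjoint (i : I) (u : H) :
    inner ℝ (B.b i) (adjoint ι u) = B.s i * inner ℝ (B.e i) u := by
  rw [adjoint_inner_right, B.map_apply, real_inner_smul_left]

theorem injective : Function.Injective ι := fun x y hxy => eq_of_forall_inner_eq B.b fun i =>
  mul_left_cancel₀ (B.pos i).ne' (by rw [← B.inner_map, hxy, B.inner_map])

end SingularBasis

theorem exists_singularBasis_of_hilbertBasis {ι : E →L[ℝ] H} (hd : DenseRange ι)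
    (hi : Function.Injective ι) {I : Type*} (e : HilbertBasis I ℝ H) {κ : I → ℝ}
    (he : ∀ i, ι (adjoint ι (e i)) = κ i • e i) : Nonempty (SingularBasis ι I) := by
  have hpos : ∀ i, 0 < ‖adjoint ι (e i)‖ := fun i => norm_pos_iff.2 fun h =>
    e.orthonormal.ne_zero i (adjoint_injective_of_denseRange hd (h.trans (map_zero _).symm))
  have hb : Orthonormal ℝ fun i => ‖adjoint ι (e i)‖⁻¹ • adjoint ι (e i) := by
    refine ⟨fun i => ?_, fun i k hik => ?_⟩
    · rw [norm_smul, norm_inv, norm_norm, inv_mul_cancel₀ (hpos i).ne']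
    · beta_reduce
      rw [real_inner_smul_left, real_inner_smul_right, adjoint_inner_right, he,
        real_inner_smul_left, e.orthonormal.2 hik, mul_zero, mul_zero, mul_zero]
  refine ⟨⟨.mkOfOrthogonalEqBot hb ((Submodule.eq_bot_iff _).2 fun v hv => hi ?_), e,
    fun i => ‖adjoint ι (e i)‖, hpos, fun i => ?_⟩⟩
  · refine eq_of_forall_inner_eq e fun i => ?_
    have hvi := Submodule.mem_orthogonal _ _ |>.1 hv _ (Submodule.subset_span ⟨i, rfl⟩)
    rw [real_inner_smul_left, adjoint_inner_left] at hvi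
    rw [map_zero, inner_zero_right]
    exact (mul_eq_zero.1 hvi).resolve_left (inv_ne_zero (hpos i).ne')
  · rw [HilbertBasis.coe_mkOfOrthogonalEqBot, smul_smul, mul_inv_cancel₀ (hpos i).ne', one_smul]

theorem exists_singularBasis.{u, v} {E : Type u} {H : Type v}
    [NormedAddCommGroup E] [InnerProductSpace ℝ E] [CompleteSpace E]
    [NormedAddCommGroup H] [InnerProductSpace ℝ H] [CompleteSpace H] {ι : E →L[ℝ] H}
    (hc : IsCompactOperator ι) (hd : DenseRange ι) (hi : Function.Injective ι) :
    ∃ (I : Type v) (_ : Countable I), Nonempty (SingularBasis ι I) := by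
  have hS : ((ι ∘L adjoint ι : H →L[ℝ] H) : H →ₗ[ℝ] H).IsSymmetric := fun x y => by
    change inner ℝ (ι (adjoint ι x)) y = inner ℝ x (ι (adjoint ι y))
    rw [← adjoint_inner_right, adjoint_inner_left]
  obtain ⟨w, e, he⟩ := exists_hilbertBasis_eigenvectors (hc.comp_clm (adjoint ι)) hS
  have := separableSpace_of_isCompactOperator hc hd
  exact ⟨_, countable_of_orthonormal e.orthonormal, exists_singularBasis_of_hilbertBasis hd hi e he⟩

end SingularBasis

namespace SingularBasis

open ContinuousLinearMap (adjoint)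

variable {E H : Type*} [NormedAddCommGroup E] [InnerProductSpace ℝ E] [CompleteSpace E]
  [NormedAddCommGroup H] [InnerProductSpace ℝ H] [CompleteSpace H]
  {ι : E →L[ℝ] H} {I : Type*} (B : SingularBasis ι I)
  {s : Set ℝ} {w u g : ℝ → H} {z : ℝ → E} {z₀ : E} {a : ℝ}
include B

/-- With `w = ι z`, the left-hand side is the square of the coordinate `⟪bᵢ, z⟫`. -/
theorem isPrimitiveOn_coordinate_sq (hs : s.OrdConnected) (h : IsPrimitiveOn s w g)
    (hw : ∀ᵐ t ∂volume.restrict s, w t = ι (adjoint ι (u t))) (i : I) :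
    IsPrimitiveOn s (fun t => ((B.s i)⁻¹ * inner ℝ (B.e i) (w t)) ^ 2)
      (fun t => 2 * (inner ℝ (B.e i) (u t) * inner ℝ (B.e i) (g t))) := by
  have hc := h.clm_comp ((B.s i)⁻¹ • innerSL ℝ (B.e i))
  simp only [smul_apply, innerSL_apply_apply, smul_eq_mul] at hc
  simp only [sq]
  refine (hc.mul hs hc).congr_ae hs ?_
  filter_upwards [hw] with t ht
  have := (B.pos i).ne'
  rw [ht, B.inner_map, B.inner_adjoint]
  field_simp
  ring

theorem coordinate_eq (i : I) (x : E) :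
    (B.s i)⁻¹ * inner ℝ (B.e i) (ι x) = inner ℝ (B.b i) x := by
  rw [B.inner_map, inv_mul_cancel_left₀ (B.pos i).ne']

theorem coordinate_sq_le (hs : s.OrdConnected) (h : IsPrimitiveOn s w g)
    (hw : ∀ᵐ t ∂volume.restrict s, w t = ι (adjoint ι (u t)))
    (hu : MemLp u 2 (volume.restrict s)) (hg : MemLp g 2 (volume.restrict s))
    (ha : a ∈ s) (hz₀ : ι z₀ = w a) (i : I) {t : ℝ} (ht : t ∈ s) :
    ((B.s i)⁻¹ * inner ℝ (B.e i) (w t)) ^ 2 ≤ inner ℝ (B.b i) z₀ ^ 2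
      + ((∫ r in s, inner ℝ (B.e i) (u r) * inner ℝ (B.e i) (u r))
        + ∫ r in s, inner ℝ (B.e i) (g r) * inner ℝ (B.e i) (g r)) := by
  have hi : ∀ {v : ℝ → H}, MemLp v 2 (volume.restrict s) →
      IntegrableOn (fun r => inner ℝ (B.e i) (v r) * inner ℝ (B.e i) (v r)) s := fun hv => by
    simpa only [sq, IntegrableOn] using (hv.const_inner (B.e i)).integrable_sq
  have hat : uIoc a t ⊆ s := uIoc_subset_uIcc.trans (hs.uIcc_subset ha ht)
  have hle : ∫ r in a..t, 2 * (inner ℝ (B.e i) (u r) * inner ℝ (B.e i) (g r))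
      ≤ ∫ r in s, (inner ℝ (B.e i) (u r) * inner ℝ (B.e i) (u r)
        + inner ℝ (B.e i) (g r) * inner ℝ (B.e i) (g r)) := by
    refine (Real.le_norm_self _).trans (intervalIntegral.norm_integral_le_integral_norm_uIoc.trans
      ((integral_mono_of_nonneg (.of_forall fun _ => norm_nonneg _)
        (((hi hu).add (hi hg)).mono_set hat) (.of_forall fun r => ?_)).trans
        (setIntegral_mono_set ((hi hu).add (hi hg)) (.of_forall fun r =>
          add_nonneg (mul_self_nonneg _) (mul_self_nonneg _)) hat.eventuallyLE)))
    simp only [Pi.add_apply, Real.norm_eq_abs, abs_le]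
    constructor <;> nlinarith [sq_nonneg (inner ℝ (B.e i) (u r) + inner ℝ (B.e i) (g r)),
      sq_nonneg (inner ℝ (B.e i) (u r) - inner ℝ (B.e i) (g r))]
  have hdiff := (B.isPrimitiveOn_coordinate_sq hs h hw i a ha t ht).2
  rw [integral_add (hi hu) (hi hg)] at hle
  rw [← B.coordinate_eq, hz₀]
  linarith

variable [Countable I]

/-- The energy identity of Lions and Magenes. -/
theorem isPrimitiveOn_norm_sq (hs : s.OrdConnected) (h : IsPrimitiveOn s (fun t => ι (z t)) g)
    (hz : ∀ᵐ t ∂volume.restrict s, z t = adjoint ι (u t))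
    (hu : MemLp u 2 (volume.restrict s)) (hg : MemLp g 2 (volume.restrict s)) :
    IsPrimitiveOn s (fun t => ‖z t‖ ^ 2) (fun t => 2 * inner ℝ (u t) (g t)) := by
  intro a ha b hb
  have hab : volume.restrict (uIoc a b) ≤ volume.restrict s :=
    Measure.restrict_mono (uIoc_subset_uIcc.trans (hs.uIcc_subset ha hb)) le_rfl
  have hu' := hu.mono_measure hab
  have hg' := hg.mono_measure hab
  refine ⟨intervalIntegrable_iff.2 ((integrable_inner_of_memLp hu' hg').const_mul 2), ?_⟩
  have hcoord : ∀ i, inner ℝ (B.b i) (z b) ^ 2 - inner ℝ (B.b i) (z a) ^ 2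
      = ∫ t in a..b, 2 * (inner ℝ (B.e i) (u t) * inner ℝ (B.e i) (g t)) := fun i => by
    rw [(B.isPrimitiveOn_coordinate_sq hs h (hz.mono fun t ht => congrArg ι ht) i a ha b hb).2]
    simp only [B.coordinate_eq]
  have hsum := (hasSum_inner_sq B.b (z b)).sub (hasSum_inner_sq B.b (z a))
  simp only [hcoord, intervalIntegral.intervalIntegral_eq_integral_uIoc, integral_const_mul]
    at hsum
  simp only [intervalIntegral.intervalIntegral_eq_integral_uIoc, integral_const_mul]
  exact (((hasSum_integral_inner_mul_inner B.e hu' hg').mul_left 2).const_smul _).unique hsum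

/-- A function of `L²(s; D(A)) ∩ H¹(s; H)` has a representative which is continuous with values
in the intermediate space `E`. -/
theorem exists_continuousOn_map_eq (hs : s.OrdConnected) (h : IsPrimitiveOn s w g)
    (hw : ∀ᵐ t ∂volume.restrict s, w t = ι (adjoint ι (u t)))
    (hu : MemLp u 2 (volume.restrict s)) (hg : MemLp g 2 (volume.restrict s))
    (ha : a ∈ s) (hz₀ : ι z₀ = w a) :
    ∃ z : ℝ → E, ContinuousOn z s ∧ ∀ t ∈ s, ι (z t) = w t := by
  obtain ⟨ζ, hζ, hζc⟩ := exists_continuous_of_coordinates B.b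
    (c := fun i (t : s) => (B.s i)⁻¹ * inner ℝ (B.e i) (w t))
    (fun i => continuous_const.mul (continuous_const.inner (h.continuousOn hs).domRestrict))
    ((hasSum_inner_sq B.b z₀).summable.add
      ((hasSum_integral_inner_mul_inner B.e hu hu).summable.add
        (hasSum_integral_inner_mul_inner B.e hg hg).summable))
    fun i t => B.coordinate_sq_le hs h hw hu hg ha hz₀ i t.2
  have hext : ∀ t : s, Function.extend Subtype.val ζ 0 t = ζ t :=
    Subtype.val_injective.extend_apply ζ 0
  refine ⟨Function.extend Subtype.val ζ 0, ?_, fun t ht => eq_of_forall_inner_eq B.e fun i => ?_⟩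
  · rw [continuousOn_iff_continuous_domRestrict]
    exact hζ.congr fun t => (hext t).symm
  · rw [B.inner_map, hext ⟨t, ht⟩, hζc, mul_inv_cancel_left₀ (B.pos i).ne']

end SingularBasis

section BoundedFamily

open ContinuousLinearMap (adjoint)
open TopologicalSpace (SeparableSpace)

variable {H : Type*} [NormedAddCommGroup H] [InnerProductSpace ℝ H] {α : Type*}
  [MeasurableSpace α] {m : Measure α} {N : α → H →L[ℝ] H} {u : α → H}

/-- A weakly measurable and essentially bounded family of operators: an element of
`L^∞(m, L(H))`. -/
structure IsBoundedFamily (N : α → H →L[ℝ] H) (m : Measure α) : Prop where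
  aemeasurable : ∀ h k, AEMeasurable (fun t => inner ℝ (N t h) k) m
  exists_bound : ∃ K, ∀ᵐ t ∂m, ‖N t‖ ≤ K

namespace IsBoundedFamily

theorem mono_measure {m' : Measure α} (hN : IsBoundedFamily N m) (hm : m' ≤ m) :
    IsBoundedFamily N m' where
  aemeasurable h k := (hN.aemeasurable h k).mono_measure hm
  exists_bound := hN.exists_bound.imp fun _ hK => ae_mono hm hK

variable [CompleteSpace H]

protected theorem adjoint (hN : IsBoundedFamily N m) :
    IsBoundedFamily (fun t => adjoint (N t)) m where
  aemeasurable h k := by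
    simpa only [ContinuousLinearMap.adjoint_inner_left, real_inner_comm] using hN.aemeasurable k h
  exists_bound := by simpa only [LinearIsometryEquiv.norm_map] using hN.exists_bound

variable [SeparableSpace H]

theorem aestronglyMeasurable_apply (hN : IsBoundedFamily N m) (hu : AEStronglyMeasurable u m) :
    AEStronglyMeasurable (fun t => N t (u t)) m :=
  aestronglyMeasurable_of_forall_inner fun k => by
    have hk : AEStronglyMeasurable (fun t => adjoint (N t) k) m :=
      aestronglyMeasurable_of_forall_inner fun h => hN.adjoint.aemeasurable k h
    simpa only [ContinuousLinearMap.adjoint_inner_right] using (hu.inner (𝕜 := ℝ) hk).aemeasurable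

theorem memLp_apply (hN : IsBoundedFamily N m) (hu : MemLp u 2 m) :
    MemLp (fun t => N t (u t)) 2 m := by
  obtain ⟨K, hK⟩ := hN.exists_bound
  exact .of_le_mul hu (hN.aestronglyMeasurable_apply hu.1)
    (hK.mono fun t ht => (N t).le_of_opNorm_le ht (u t))

end IsBoundedFamily

end BoundedFamily

section Existence

open ContinuousLinearMap (adjoint)
open SchwartzMap (derivCLM)
open TopologicalSpace (SeparableSpace)
open scoped SchwartzMap

variable {E H : Type*} [NormedAddCommGroup E] [InnerProductSpace ℝ E]
  [NormedAddCommGroup H] [InnerProductSpace ℝ H]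

theorem exists_linearMap_Lp_ae_eq {α Φ F : Type*} [MeasurableSpace α] {m : Measure α}
    [AddCommGroup Φ] [Module ℝ Φ] [NormedAddCommGroup F] [NormedSpace ℝ F]
    (T : Φ →ₗ[ℝ] α → F) (hT : ∀ φ, MemLp (T φ) 2 m) :
    ∃ K : Φ →ₗ[ℝ] Lp F 2 m, ∀ φ, K φ =ᵐ[m] T φ :=
  ⟨{ toFun := fun φ => (hT φ).toLp
     map_add' := fun φ ψ => by
      simp only [map_add]
      exact MemLp.toLp_add (hT φ) (hT ψ)
     map_smul' := fun c φ => by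
      simp only [map_smul]
      exact MemLp.toLp_const_smul c (hT φ) }, fun φ => (hT φ).coeFn_toLp⟩

theorem memLp_schwartzMap_deriv (φ : 𝓢(ℝ, H)) : MemLp (deriv φ) 2 :=
  (derivCLM ℝ H φ).memLp 2 volume

theorem integral_Ioi_inner_deriv (j : H →L[ℝ] E) (φ : 𝓢(ℝ, H)) :
    ∫ t in Ioi 0, inner ℝ (j (φ t)) (j (deriv φ t)) = -(‖j (φ 0)‖ ^ 2 / 2) := by
  have hd : ∀ t, HasDerivAt (fun t => ‖j (φ t)‖ ^ 2 / 2)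
      (inner ℝ (j (φ t)) (j (deriv φ t))) t := fun t => by
    simpa using (j.hasFDerivAt.comp_hasDerivAt t (φ.hasDerivAt t)).norm_sq.div_const 2
  have hlim : Tendsto (fun t => ‖j (φ t)‖ ^ 2 / 2) atTop (𝓝 0) := by
    have := ((j.continuous.tendsto 0).comp
      (φ.tendsto_cocompact.mono_left atTop_le_cocompact)).norm.pow 2 |>.div_const 2
    simpa using this
  rw [integral_Ioi_of_hasDerivAt_of_tendsto' (fun t _ => hd t) ?_ hlim, zero_sub]
  exact integrable_inner_of_memLp (j.comp_memLp' ((φ.memLp 2).restrict _))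
    (j.comp_memLp' ((memLp_schwartzMap_deriv φ).restrict _))

variable [CompleteSpace E] [CompleteSpace H]

/-- The formal adjoint `φ ↦ -ι ι* φ' + N* φ` of `u ↦ (ι ι* u)' + N u`, on test functions. -/
noncomputable def formalAdjoint (ι : E →L[ℝ] H) (N : ℝ → H →L[ℝ] H) : 𝓢(ℝ, H) →ₗ[ℝ] ℝ → H where
  toFun φ t := adjoint (N t) (φ t) - ι (adjoint ι (deriv φ t))
  map_add' φ ψ := funext fun t => by
    simp only [← SchwartzMap.derivCLM_apply ℝ, map_add, add_apply, Pi.add_apply]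
    abel
  map_smul' c φ := funext fun t => by
    simp only [← SchwartzMap.derivCLM_apply ℝ, map_smul, smul_apply, Pi.smul_apply,
      smul_sub, RingHom.id_apply]

variable {ι : E →L[ℝ] H} {N : ℝ → H →L[ℝ] H} {α : ℝ}

theorem inner_formalAdjoint (h : H) (φ : 𝓢(ℝ, H)) (t : ℝ) :
    inner ℝ h (formalAdjoint ι N φ t)
      = inner ℝ (N t h) (φ t) - inner ℝ (adjoint ι h) (adjoint ι (deriv φ t)) := by
  simp only [formalAdjoint, LinearMap.coe_mk, AddHom.coe_mk, inner_sub_right,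
    ContinuousLinearMap.adjoint_inner_right, ← ContinuousLinearMap.adjoint_inner_left ι]

variable [SeparableSpace H]

theorem memLp_formalAdjoint (hN : IsBoundedFamily N (volume.restrict (Ioi 0))) (φ : 𝓢(ℝ, H)) :
    MemLp (formalAdjoint ι N φ) 2 (volume.restrict (Ioi 0)) :=
  (hN.adjoint.memLp_apply ((φ.memLp 2).restrict _)).sub
    ((ι ∘L adjoint ι).comp_memLp' ((memLp_schwartzMap_deriv φ).restrict _))

theorem half_norm_sq_add_le_integral_inner_formalAdjoint
    (hN : IsBoundedFamily N (volume.restrict (Ioi 0)))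
    (hc : ∀ᵐ t ∂volume.restrict (Ioi (0 : ℝ)), ∀ h, α * ‖h‖ ^ 2 ≤ inner ℝ (N t h) h)
    (φ : 𝓢(ℝ, H)) :
    ‖adjoint ι (φ 0)‖ ^ 2 / 2 + α * ∫ t in Ioi 0, ‖φ t‖ ^ 2
      ≤ ∫ t in Ioi 0, inner ℝ (φ t) (formalAdjoint ι N φ t) := by
  have hφ : MemLp φ 2 (volume.restrict (Ioi 0)) := (φ.memLp 2).restrict _
  have hφ' : MemLp (deriv φ) 2 (volume.restrict (Ioi 0)) := (memLp_schwartzMap_deriv φ).restrict _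
  have hNφ := integrable_inner_of_memLp (hN.memLp_apply hφ) hφ
  have hle : α * ∫ t in Ioi 0, ‖φ t‖ ^ 2 ≤ ∫ t in Ioi 0, inner ℝ (N t (φ t)) (φ t) := by
    rw [← integral_const_mul]
    exact integral_mono_ae (hφ.norm.integrable_sq.const_mul α) hNφ (hc.mono fun t ht => ht (φ t))
  have hιφ : Integrable (fun t => inner ℝ (adjoint ι (φ t)) (adjoint ι (deriv φ t)))
      (volume.restrict (Ioi 0)) :=
    integrable_inner_of_memLp ((adjoint ι).comp_memLp' hφ) ((adjoint ι).comp_memLp' hφ')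
  simp only [inner_formalAdjoint]
  rw [integral_sub hNφ hιφ, integral_Ioi_inner_deriv]
  linarith

theorem exists_memLp_weak_solution (ι : E →L[ℝ] H)
    (hN : IsBoundedFamily N (volume.restrict (Ioi 0))) (hα : 0 < α)
    (hc : ∀ᵐ t ∂volume.restrict (Ioi (0 : ℝ)), ∀ h, α * ‖h‖ ^ 2 ≤ inner ℝ (N t h) h) (z₀ : E) :
    ∃ u : ℝ → H, MemLp u 2 (volume.restrict (Ioi 0)) ∧ ∀ φ : 𝓢(ℝ, H),
      ∫ t in Ioi 0, inner ℝ (u t) (formalAdjoint ι N φ t) = inner ℝ (ι z₀) (φ 0) := by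
  obtain ⟨K, hK⟩ := exists_linearMap_Lp_ae_eq (formalAdjoint ι N) (memLp_formalAdjoint hN)
  have hbound : ∀ φ : 𝓢(ℝ, H),
      |inner ℝ (ι z₀) (φ 0)| ≤ ‖z₀‖ * √(1 / (2 * α)) * ‖K φ‖ := fun φ => by
    have hφ : MemLp φ 2 (volume.restrict (Ioi 0)) := (φ.memLp 2).restrict _
    have hPK : inner ℝ hφ.toLp (K φ) = ∫ t in Ioi 0, inner ℝ (φ t) (formalAdjoint ι N φ t) := by
      refine integral_congr_ae ?_
      filter_upwards [hφ.coeFn_toLp, hK φ] with t ht ht'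
      rw [ht, ht']
    have hP : ‖hφ.toLp‖ ^ 2 = ∫ t in Ioi 0, ‖φ t‖ ^ 2 := by
      rw [← real_inner_self_eq_norm_sq]
      refine integral_congr_ae ?_
      filter_upwards [hφ.coeFn_toLp] with t ht
      rw [ht, real_inner_self_eq_norm_sq]
    have hle := half_norm_sq_add_le_integral_inner_formalAdjoint (ι := ι) hN hc φ
    rw [← hP, ← hPK] at hle
    have hφ₀ : ‖adjoint ι (φ 0)‖ ≤ √(1 / (2 * α)) * ‖K φ‖ := by
      refine le_of_sq_le_sq ?_ (by positivity)
      rw [mul_pow, Real.sq_sqrt (by positivity), div_mul_eq_mul_div, one_mul,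
        le_div_iff₀ (by positivity)]
      nlinarith [real_inner_le_norm hφ.toLp (K φ), sq_nonneg (‖K φ‖ - 2 * α * ‖hφ.toLp‖)]
    rw [← ContinuousLinearMap.adjoint_inner_right, mul_assoc]
    exact (abs_real_inner_le_norm _ _).trans (mul_le_mul_of_nonneg_left hφ₀ (norm_nonneg _))
  obtain ⟨u, hu⟩ := exists_inner_eq_of_abs_le_mul_norm K
    { toFun := fun φ => inner ℝ (ι z₀) (φ 0)
      map_add' := fun _ _ => inner_add_right _ _ _
      map_smul' := fun _ _ => real_inner_smul_right _ _ _ } _ hbound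
  refine ⟨u, Lp.memLp u, fun φ => (integral_congr_ae ?_).trans (hu φ)⟩
  filter_upwards [hK φ] with t ht
  rw [ht]

omit [CompleteSpace E] [CompleteSpace H] [SeparableSpace H]

theorem integrableOn_smul_of_memLp {η : ℝ → ℝ} {w : ℝ → H} {s : Set ℝ} (hη : Continuous η)
    (hηc : HasCompactSupport η) (hw : MemLp w 2 (volume.restrict s)) :
    IntegrableOn (fun t => η t • w t) s :=
  memLp_one_iff_integrable.1 (hw.smul ((hη.memLp_of_hasCompactSupport (p := 2) hηc).restrict s))

variable [CompleteSpace H] {v g : ℝ → H} {a : H}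

theorem setIntegral_smul_add_of_weak
    (hv : MemLp v 2 (volume.restrict (Ioi 0))) (hg : MemLp g 2 (volume.restrict (Ioi 0)))
    (h : ∀ φ : 𝓢(ℝ, H),
      ∫ t in Ioi 0, (inner ℝ (v t) (deriv φ t) + inner ℝ (g t) (φ t)) = -inner ℝ a (φ 0))
    {φ : ℝ → ℝ} (hφ : ContDiff ℝ ∞ φ) (hφc : HasCompactSupport φ) :
    ∫ t in Ioi 0, (deriv φ t • v t + φ t • g t) = -(φ 0 • a) := by
  have hi : IntegrableOn (fun t => deriv φ t • v t + φ t • g t) (Ioi 0) :=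
    (integrableOn_smul_of_memLp (hφ.continuous_deriv (by simp)) hφc.deriv hv).add
      (integrableOn_smul_of_memLp hφ.continuous hφc hg)
  refine ext_inner_left ℝ fun k => ?_
  have hd : ∀ t, deriv (fun t => φ t • k) t = deriv φ t • k := fun t =>
    deriv_smul_const ((hφ.differentiable (by simp)) t) k
  have hk : ∫ t in Ioi 0, (inner ℝ (v t) (deriv (fun t => φ t • k) t) + inner ℝ (g t) (φ t • k))
      = -inner ℝ a (φ 0 • k) :=
    h ((hφc.smul_right (f' := fun _ => k)).toSchwartzMap (hφ.smul contDiff_const))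
  simp only [hd] at hk
  rw [← integral_inner hi]
  simpa only [inner_add_right, inner_neg_right, real_inner_smul_right, real_inner_comm k] using hk

/-- The weak formulation says that `v - a` and `g`, extended by zero to negative times, are
related by distributional derivation: this encodes the initial condition `v(0) = a`. -/
theorem isDistribDeriv_indicator_of_weak
    (hv : MemLp v 2 (volume.restrict (Ioi 0))) (hg : MemLp g 2 (volume.restrict (Ioi 0)))
    (h : ∀ φ : 𝓢(ℝ, H),
      ∫ t in Ioi 0, (inner ℝ (v t) (deriv φ t) + inner ℝ (g t) (φ t)) = -inner ℝ a (φ 0)) :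
    IsDistribDeriv univ ((Ioi 0).indicator fun t => v t - a)
      ((Ioi 0).indicator g) := by
  intro φ hφ hφc _
  have hφ₁ : Continuous (deriv φ) := hφ.continuous_deriv (by simp)
  have hgi := integrableOn_smul_of_memLp hφ.continuous hφc hg
  have hvi := integrableOn_smul_of_memLp hφ₁ hφc.deriv hv
  have hai : IntegrableOn (fun t => deriv φ t • a) (Ioi 0) :=
    ((hφ₁.integrable_of_hasCompactSupport hφc.deriv).smul_const a).integrableOn
  have hweak := setIntegral_smul_add_of_weak hv hg h hφ hφc
  have ha : ∫ t in Ioi 0, deriv φ t • a = -(φ 0 • a) := by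
    rw [integral_smul_const, hφc.integral_Ioi_deriv_eq (hφ.of_le (by simp)), neg_smul]
  rw [integral_add hvi hgi] at hweak
  simp only [← indicator_smul_apply, Measure.restrict_univ, integral_indicator measurableSet_Ioi,
    smul_sub]
  rw [integral_sub hvi hai, ha, ← hweak]
  abel

theorem ae_eq_add_integral_of_weak
    (hv : MemLp v 2 (volume.restrict (Ioi 0))) (hg : MemLp g 2 (volume.restrict (Ioi 0)))
    (h : ∀ φ : 𝓢(ℝ, H),
      ∫ t in Ioi 0, (inner ℝ (v t) (deriv φ t) + inner ℝ (g t) (φ t)) = -inner ℝ a (φ 0)) :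
    ∀ᵐ t ∂volume.restrict (Ioi (0 : ℝ)), v t = a + ∫ r in (0 : ℝ)..t, g r := by
  have hloc : ∀ {w : ℝ → H}, MemLp w 2 (volume.restrict (Ioi 0)) →
      LocallyIntegrable ((Ioi 0).indicator w) := fun hw =>
    ((memLp_indicator_iff_restrict measurableSet_Ioi).2 hw).locallyIntegrable one_le_two
  have hq : ∀ b c, IntervalIntegrable ((Ioi 0).indicator g) volume b c := fun b c =>
    ((hloc hg).integrableOn_isCompact isCompact_uIcc).intervalIntegrable
  have hf : LocallyIntegrable ((Ioi (0 : ℝ)).indicator fun t => v t - a) := by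
    rw [indicator_sub]
    exact (hloc hv).sub ((locallyIntegrable_const a).indicator measurableSet_Ioi)
  set f := (Ioi (0 : ℝ)).indicator fun t => v t - a
  set q := (Ioi (0 : ℝ)).indicator g
  obtain ⟨c, hc⟩ := (isDistribDeriv_indicator_of_weak hv hg h).exists_ae_sub_eq_const isOpen_univ
    (hf.locallyIntegrableOn _) (.of_integral (mem_univ 0) 0 fun b _ d _ => hq b d)
  rw [Measure.restrict_univ] at hc
  have hc0 : c = 0 := by
    have hIic : volume (Iic (0 : ℝ)) ≠ 0 := by simp
    obtain ⟨t, ht, htc⟩ := ((frequently_ae_mem_iff.2 hIic).and_eventually hc).exists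
    rw [← htc, indicator_of_notMem (notMem_Ioi.2 ht), zero_sub, zero_add, neg_eq_zero]
    refine (intervalIntegral.integral_congr fun r hr => indicator_of_notMem ?_ _).trans
      intervalIntegral.integral_zero
    rw [uIcc_of_ge ht] at hr
    exact notMem_Ioi.2 hr.2
  filter_upwards [ae_restrict_of_ae hc, ae_restrict_mem measurableSet_Ioi] with t ht ht0
  have hqg : ∫ r in (0 : ℝ)..t, q r = ∫ r in (0 : ℝ)..t, g r := by
    refine intervalIntegral.integral_congr_ae (.of_forall fun r hr => indicator_of_mem ?_ _)
    rw [uIoc_of_le (le_of_lt (mem_Ioi.1 ht0))] at hr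
    exact hr.1
  rw [hc0, zero_add, hqg, indicator_of_mem ht0] at ht
  rw [← sub_eq_zero, ← ht]
  abel

end Existence

theorem intervalIntegrable_of_memLp {F : Type*} [NormedAddCommGroup F] {g : ℝ → F} {s : Set ℝ}
    {p : ENNReal} {a b : ℝ} (hp : 1 ≤ p) (hs : s.OrdConnected)
    (hg : MemLp g p (volume.restrict s)) (ha : a ∈ s) (hb : b ∈ s) :
    IntervalIntegrable g volume a b :=
  have : IsFiniteMeasure (volume.restrict (uIoc a b)) := ⟨by simp⟩
  intervalIntegrable_iff.2 <| (hg.mono_measure <| Measure.restrict_mono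
    (uIoc_subset_uIcc.trans (hs.uIcc_subset ha hb)) le_rfl).integrable hp

theorem restrict_uIcc_le_restrict_Ioo {a b : ℝ} (ha : 0 ≤ a) (hb : 0 ≤ b) :
    volume.restrict (uIcc a b) ≤ volume.restrict (Ioo 0 (max a b + 1)) := by
  rw [Measure.restrict_congr_set Ioo_ae_eq_Ico]
  exact Measure.restrict_mono
    (Icc_subset_Ico (le_min ha hb) (lt_add_one (max a b))) le_rfl

section StrongSolution

open ContinuousLinearMap (adjoint)
open TopologicalSpace (SeparableSpace)

variable {E H : Type*} [NormedAddCommGroup E] [InnerProductSpace ℝ E] [CompleteSpace E]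
  [NormedAddCommGroup H] [InnerProductSpace ℝ H] [CompleteSpace H]

/-- `(z, u)` is a strong solution, on the half-line `[0, ∞)`, of `(ι z)' + N(t) u = 0`,
`z = ι* u`. -/
structure IsStrongSolution (ι : E →L[ℝ] H) (N : ℝ → H →L[ℝ] H) (z : ℝ → E) (u : ℝ → H) :
    Prop where
  continuousOn : ContinuousOn z (Ici 0)
  isPrimitiveOn : IsPrimitiveOn (Ici 0) (fun t => ι (z t)) (fun t => -N t (u t))
  ae_eq : ∀ᵐ t ∂volume.restrict (Ioi (0 : ℝ)), z t = adjoint ι (u t)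
  memLp : ∀ τ : ℝ, 0 < τ → MemLp u 2 (volume.restrict (Ioo 0 τ))

variable {ι : E →L[ℝ] H} {I : Type*} [Countable I] {N : ℝ → H →L[ℝ] H} [SeparableSpace H]
  {z z' : ℝ → E} {u u' : ℝ → H} {a b α μ : ℝ}

theorem exists_isStrongSolution (B : SingularBasis ι I)
    (hN : IsBoundedFamily N (volume.restrict (Ioi 0))) (hα : 0 < α)
    (hc : ∀ᵐ t ∂volume.restrict (Ioi (0 : ℝ)), ∀ h, α * ‖h‖ ^ 2 ≤ inner ℝ (N t h) h) (z₀ : E) :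
    ∃ z u, IsStrongSolution ι N z u ∧ z 0 = z₀ ∧ MemLp u 2 (volume.restrict (Ioi 0)) := by
  obtain ⟨u, hu, hweak⟩ := exists_memLp_weak_solution ι hN hα hc z₀
  have hNu := (hN.memLp_apply hu).neg
  set w : ℝ → H := fun t => ι z₀ + ∫ r in (0 : ℝ)..t, -N r (u r)
  have hw : ∀ᵐ t ∂volume.restrict (Ioi (0 : ℝ)), w t = ι (adjoint ι (u t)) := by
    refine (ae_eq_add_integral_of_weak ((ι ∘L adjoint ι).comp_memLp' hu) hNu fun φ => ?_).mono
      fun t ht => ht.symm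
    rw [← hweak φ, ← integral_neg]
    simp [inner_formalAdjoint, ← ContinuousLinearMap.adjoint_inner_right, sub_eq_add_neg]
  have hIci : volume.restrict (Ioi (0 : ℝ)) = volume.restrict (Ici 0) :=
    restrict_Ioi_eq_restrict_Ici
  have hwp : IsPrimitiveOn (Ici 0) w (fun t => -N t (u t)) :=
    .of_integral self_mem_Ici _ fun a ha b hb => intervalIntegrable_of_memLp one_le_two
      ordConnected_Ici (hIci ▸ hNu) ha hb
  have hw₀ : w 0 = ι z₀ := by simp [w]
  obtain ⟨z, hzc, hz⟩ := B.exists_continuousOn_map_eq ordConnected_Ici hwp (hIci ▸ hw)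
    (hIci ▸ hu) (hIci ▸ hNu) self_mem_Ici hw₀.symm
  refine ⟨z, u, ⟨hzc, hwp.congr fun t ht => (hz t ht).symm, ?_, fun τ _ =>
    hu.mono_measure (Measure.restrict_mono Ioo_subset_Ioi_self le_rfl)⟩,
    B.injective (by rw [hz 0 self_mem_Ici, hw₀]), hu⟩
  filter_upwards [hw, ae_restrict_mem measurableSet_Ioi] with t ht h₀
  exact B.injective (by rw [hz t (Ioi_subset_Ici_self h₀), ht])

namespace IsStrongSolution

omit [SeparableSpace H] in
protected theorem sub (h : IsStrongSolution ι N z u) (h' : IsStrongSolution ι N z' u') :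
    IsStrongSolution ι N (fun t => z t - z' t) (fun t => u t - u' t) where
  continuousOn := h.continuousOn.sub h'.continuousOn
  isPrimitiveOn := by
    convert h.isPrimitiveOn.sub h'.isPrimitiveOn using 2 with t t
    · exact map_sub ι _ _
    · rw [map_sub]
      abel
  ae_eq := by
    filter_upwards [h.ae_eq, h'.ae_eq] with t ht ht'
    rw [ht, ht', map_sub]
  memLp τ hτ := (h.memLp τ hτ).sub (h'.memLp τ hτ)

theorem isPrimitiveOn_norm_sq (h : IsStrongSolution ι N z u) (B : SingularBasis ι I)
    (hN : IsBoundedFamily N (volume.restrict (Ioi 0))) :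
    IsPrimitiveOn (Ici 0) (fun t => ‖z t‖ ^ 2) (fun t => -2 * inner ℝ (N t (u t)) (u t)) := by
  intro a ha b hb
  have hIcc := restrict_uIcc_le_restrict_Ioo ha hb
  have hIoi := hIcc.trans (Measure.restrict_mono Ioo_subset_Ioi_self le_rfl)
  have hτ : 0 < max a b + 1 := add_pos_of_nonneg_of_pos (le_max_of_le_left ha) one_pos
  have hu := (h.memLp _ hτ).mono_measure hIcc
  have hNu := ((hN.mono_measure hIoi).memLp_apply hu).neg
  have := B.isPrimitiveOn_norm_sq ordConnected_uIcc
    (h.isPrimitiveOn.mono (ordConnected_Ici.uIcc_subset ha hb))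
    (ae_mono hIoi h.ae_eq) hu hNu a left_mem_uIcc b right_mem_uIcc
  simpa only [Pi.neg_apply, inner_neg_right, mul_neg, neg_mul, real_inner_comm] using this

theorem norm_le_exp_mul (h : IsStrongSolution ι N z u) (B : SingularBasis ι I)
    (hN : IsBoundedFamily N (volume.restrict (Ioi 0)))
    (hc : ∀ᵐ t ∂volume.restrict (Ioi (0 : ℝ)), ∀ h, μ * ‖adjoint ι h‖ ^ 2 ≤ inner ℝ (N t h) h)
    (ha : 0 ≤ a) (hab : a ≤ b) : ‖z b‖ ≤ Real.exp (-(μ * (b - a))) * ‖z a‖ := by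
  have hsub : Ioc a b ⊆ Ioi 0 := fun t ht => ha.trans_lt ht.1
  have hsq := ((h.isPrimitiveOn_norm_sq B hN).mono fun t ht => ha.trans ht.1).le_exp_mul
    (k := 2 * μ) hab (by
      filter_upwards [ae_restrict_of_ae_restrict_of_subset hsub h.ae_eq,
        ae_restrict_of_ae_restrict_of_subset hsub hc] with t hz ht
      rw [hz]
      linarith [ht (u t)])
  refine le_of_sq_le_sq (hsq.trans_eq ?_) (by positivity)
  rw [mul_pow, ← Real.exp_nat_mul]
  congr 2
  push_cast
  ring

theorem eqOn (h : IsStrongSolution ι N z u) (h' : IsStrongSolution ι N z' u')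
    (B : SingularBasis ι I) (hN : IsBoundedFamily N (volume.restrict (Ioi 0)))
    (hc : ∀ᵐ t ∂volume.restrict (Ioi (0 : ℝ)), ∀ h, 0 ≤ inner ℝ (N t h) h)
    (h₀ : z 0 = z' 0) : EqOn z z' (Ici 0) := fun t ht => by
  have := (h.sub h').norm_le_exp_mul (μ := 0) B hN (by simpa using hc) le_rfl ht
  simpa [h₀, sub_eq_zero] using this

theorem integral_norm_sq_le (h : IsStrongSolution ι N z u) (B : SingularBasis ι I)
    (hN : IsBoundedFamily N (volume.restrict (Ioi 0)))
    (hc : ∀ᵐ t ∂volume.restrict (Ioi (0 : ℝ)), ∀ h, α * ‖h‖ ^ 2 ≤ inner ℝ (N t h) h)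
    (hu : MemLp u 2 (volume.restrict (Ioi 0))) (ha : 0 ≤ a) :
    2 * α * ∫ t in Ioi a, ‖u t‖ ^ 2 ≤ ‖z a‖ ^ 2 := by
  have hint : IntegrableOn (fun t => ‖u t‖ ^ 2) (Ioi a) :=
    IntegrableOn.mono_set hu.norm.integrable_sq (Ioi_subset_Ioi ha)
  refine le_of_tendsto
    ((intervalIntegral_tendsto_integral_Ioi a hint tendsto_id).const_mul (2 * α)) ?_
  filter_upwards [eventually_ge_atTop a] with b hab
  obtain ⟨hi, henergy⟩ := h.isPrimitiveOn_norm_sq B hN a ha b (ha.trans hab)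
  rw [intervalIntegrable_iff_integrableOn_Ioc_of_le hab] at hi
  rw [intervalIntegral.integral_of_le hab] at henergy
  have hle : ∫ t in Ioc a b, -2 * inner ℝ (N t (u t)) (u t)
      ≤ ∫ t in Ioc a b, -(2 * α) * ‖u t‖ ^ 2 := by
    refine integral_mono_ae hi ((hint.mono_set Ioc_subset_Ioi_self).const_mul _) ?_
    filter_upwards [ae_restrict_of_ae_restrict_of_subset
      (fun t ht => ha.trans_lt ht.1 : Ioc a b ⊆ Ioi 0) hc] with t ht
    linarith [ht (u t)]
  rw [integral_const_mul (-(2 * α))] at hle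
  beta_reduce at henergy
  rw [id, intervalIntegral.integral_of_le hab]
  linarith [sq_nonneg ‖z b‖]

end IsStrongSolution

end StrongSolution

theorem norm_add_sq_le_two_mul {F : Type*} [SeminormedAddGroup F] (x y : F) :
    ‖x + y‖ ^ 2 ≤ 2 * (‖x‖ ^ 2 + ‖y‖ ^ 2) :=
  (pow_le_pow_left₀ (norm_nonneg _) (norm_add_le x y) 2).trans add_sq_le

section Penalty

variable {E X : Type*} [NormedAddCommGroup E] [NormedSpace ℝ E] [NormedAddCommGroup X]
  [NormedSpace ℝ X] {J : Type*} [Fintype J]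

theorem norm_sum_smul_sq_le (c : J → ℝ) (χ : J → X) :
    ‖∑ i, c i • χ i‖ ^ 2 ≤ (∑ i, c i ^ 2) * ∑ i, ‖χ i‖ ^ 2 := by
  have h : ‖∑ i, c i • χ i‖ ≤ ∑ i, ‖c i‖ * ‖χ i‖ := norm_sum_le_of_le _ fun i _ => norm_smul_le _ _
  simpa only [Real.norm_eq_abs, sq_abs] using
    (pow_le_pow_left₀ (norm_nonneg _) h 2).trans (Finset.sum_mul_sq_le_sq_mul_sq _ _ _)

/-- The component of `x` in the span of the `χ i` is controlled by the observations `δ i x`, and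
the observations do not see the rest, to which the Poincaré inequality `hP` applies. -/
theorem mul_norm_sq_le_of_biorthogonal [DecidableEq J] (j : X →L[ℝ] E) {δ : J → StrongDual ℝ X}
    {χ : J → X} {κ l : ℝ} (hδ : ∀ i k, δ k (χ i) = if k = i then (1 : ℝ) else 0) (hκ : 0 ≤ κ)
    (hP : ∀ x, (∀ i, δ i x = 0) → 8 * κ * ‖j x‖ ^ 2 ≤ ‖x‖ ^ 2)
    (hl : (1 / 2 + 2 * κ * ‖j‖ ^ 2) * ∑ i, ‖χ i‖ ^ 2 ≤ l) (x : X) :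
    κ * ‖j x‖ ^ 2 ≤ 1 / 2 * ‖x‖ ^ 2 + l * ∑ i, δ i x ^ 2 := by
  set p : X := ∑ i, δ i x • χ i with hp
  have hrest : 8 * κ * ‖j (x - p)‖ ^ 2 ≤ ‖x - p‖ ^ 2 := hP _ fun i => by simp [hp, hδ]
  have hseen : (1 / 2 + 2 * κ * ‖j‖ ^ 2) * ‖p‖ ^ 2 ≤ l * ∑ i, δ i x ^ 2 :=
    calc (1 / 2 + 2 * κ * ‖j‖ ^ 2) * ‖p‖ ^ 2
        ≤ (1 / 2 + 2 * κ * ‖j‖ ^ 2) * ((∑ i, δ i x ^ 2) * ∑ i, ‖χ i‖ ^ 2) := by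
          gcongr
          exact norm_sum_smul_sq_le _ _
      _ = ((1 / 2 + 2 * κ * ‖j‖ ^ 2) * ∑ i, ‖χ i‖ ^ 2) * ∑ i, δ i x ^ 2 := by ring
      _ ≤ l * ∑ i, δ i x ^ 2 := by gcongr
  have hjp : ‖j p‖ ^ 2 ≤ ‖j‖ ^ 2 * ‖p‖ ^ 2 := by
    rw [← mul_pow]
    gcongr
    exact j.le_opNorm p
  have hsub : ‖x - p‖ ^ 2 ≤ 2 * (‖x‖ ^ 2 + ‖p‖ ^ 2) := by
    simpa only [sub_eq_add_neg, norm_neg] using norm_add_sq_le_two_mul x (-p)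
  have hj : ‖j x‖ ^ 2 ≤ 2 * (‖j (x - p)‖ ^ 2 + ‖j p‖ ^ 2) := by
    simpa only [← map_add, sub_add_cancel] using norm_add_sq_le_two_mul (j (x - p)) (j p)
  calc κ * ‖j x‖ ^ 2
      ≤ κ * (2 * (‖j (x - p)‖ ^ 2 + ‖j‖ ^ 2 * ‖p‖ ^ 2)) := by gcongr; linarith
    _ ≤ 1 / 2 * ‖x‖ ^ 2 + (1 / 2 + 2 * κ * ‖j‖ ^ 2) * ‖p‖ ^ 2 := by linarith
    _ ≤ _ := by gcongr

end Penalty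

section ClosedLoop

open ContinuousLinearMap (adjoint)

variable {E H : Type*} [NormedAddCommGroup E] [InnerProductSpace ℝ E]
  [NormedAddCommGroup H] [InnerProductSpace ℝ H] {J : Type*} [Fintype J] {C μ l : ℝ}

/-- The closed-loop operator `1 + ι R + l ∑ᵢ (δᵢ, ·) δᵢ` of `H`: in the application `R` stands for
the reaction-convection operator and `δᵢ` for the actuators, all read in `H`. -/
noncomputable def closedLoop (ι : E →L[ℝ] H) (R : H →L[ℝ] E) (l : ℝ) (δ : J → H) : H →L[ℝ] H :=
  ContinuousLinearMap.id ℝ H + ι ∘L R + l • ∑ i, (innerSL ℝ (δ i)).smulRight (δ i)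

theorem closedLoop_apply (ι : E →L[ℝ] H) (R : H →L[ℝ] E) (l : ℝ) (δ : J → H) (h : H) :
    closedLoop ι R l δ h = h + ι (R h) + l • ∑ i, (inner ℝ (δ i) h : ℝ) • δ i := by
  simp [closedLoop]

theorem norm_closedLoop_le (ι : E →L[ℝ] H) {R : H →L[ℝ] E} (hR : ‖R‖ ≤ C) (l : ℝ) (δ : J → H) :
    ‖closedLoop ι R l δ‖ ≤ ‖ContinuousLinearMap.id ℝ H‖ + ‖ι‖ * C
      + ‖l • ∑ i, (innerSL ℝ (δ i)).smulRight (δ i)‖ := by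
  refine norm_add_le_of_le (norm_add_le_of_le le_rfl ?_) le_rfl
  exact (ContinuousLinearMap.opNorm_comp_le _ _).trans (by gcongr)

variable [CompleteSpace E] [CompleteSpace H] {ι : E →L[ℝ] H} {δ : J → H}

theorem inner_closedLoop (R : H →L[ℝ] E) (h k : H) :
    inner ℝ (closedLoop ι R l δ h) k = inner ℝ h k + inner ℝ (R h) (adjoint ι k)
      + l * ∑ i, inner ℝ (δ i) h * inner ℝ (δ i) k := by
  simp only [closedLoop_apply, inner_add_left, real_inner_smul_left, sum_inner,
    ContinuousLinearMap.adjoint_inner_right]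

theorem isBoundedFamily_closedLoop {α : Type*} [MeasurableSpace α] {m : Measure α}
    {R : α → H →L[ℝ] E} (hR : ∀ h x, AEMeasurable (fun t => inner ℝ (R t h) x) m)
    (hC : ∀ᵐ t ∂m, ‖R t‖ ≤ C) : IsBoundedFamily (fun t => closedLoop ι (R t) l δ) m where
  aemeasurable h k := by
    simp only [inner_closedLoop]
    exact (aemeasurable_const.add (hR h _)).add aemeasurable_const
  exists_bound := ⟨_, hC.mono fun _ ht => norm_closedLoop_le ι ht l δ⟩

theorem closedLoop_coercive {R : H →L[ℝ] E} (hR : ‖R‖ ≤ C) (hc : ∀ h,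
      (C ^ 2 + μ) * ‖adjoint ι h‖ ^ 2 ≤ 1 / 2 * ‖h‖ ^ 2 + l * ∑ i, inner ℝ (δ i) h ^ 2) (h : H) :
    1 / 4 * ‖h‖ ^ 2 + μ * ‖adjoint ι h‖ ^ 2 ≤ inner ℝ (closedLoop ι R l δ h) h := by
  have hRh : -(C * ‖h‖ * ‖adjoint ι h‖) ≤ inner ℝ (R h) (adjoint ι h) :=
    neg_le_of_abs_le <| (abs_real_inner_le_norm _ _).trans <| by
      gcongr
      exact R.le_of_opNorm_le hR h
  rw [inner_closedLoop, real_inner_self_eq_norm_sq]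
  simp only [← sq]
  nlinarith [hc h, sq_nonneg (1 / 2 * ‖h‖ - C * ‖adjoint ι h‖)]

end ClosedLoop

/-- The Riesz isomorphism of a real Hilbert space, as a linear isometry: `InnerProductSpace.toDual`
is only conjugate linear. -/
noncomputable def realRiesz (F : Type*) [NormedAddCommGroup F] [InnerProductSpace ℝ F]
    [CompleteSpace F] : StrongDual ℝ F ≃ₗᵢ[ℝ] F where
  __ := (InnerProductSpace.toDual ℝ F).symm
  map_smul' c f := by simp

theorem inner_realRiesz {F : Type*} [NormedAddCommGroup F] [InnerProductSpace ℝ F]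
    [CompleteSpace F] (f : StrongDual ℝ F) (x : F) : inner ℝ (realRiesz F f) x = f x :=
  InnerProductSpace.toDual_symm_apply

namespace DiffusionOperator

open ContinuousLinearMap (adjoint adjoint_inner_left adjoint_inner_right)

variable {V H : Type*}
  [NormedAddCommGroup V] [InnerProductSpace ℝ V] [CompleteSpace V]
  [NormedAddCommGroup H] [InnerProductSpace ℝ H] [CompleteSpace H]
  (T : DiffusionOperator V H)

theorem denseRange_VtoH : DenseRange T.VtoH :=
  T.incl_denseRange.comp T.ofEnergy.surjective.denseRange T.incl.continuous

theorem VtoH_injective : Function.Injective T.VtoH :=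
  T.incl_injective.comp T.ofEnergy.injective

theorem isCompactOperator_VtoH : IsCompactOperator T.VtoH :=
  T.incl_compact.comp_clm _

include T in
theorem separableSpace : TopologicalSpace.SeparableSpace H :=
  separableSpace_of_isCompactOperator T.isCompactOperator_VtoH T.denseRange_VtoH

theorem domToV_domAEquiv_symm (k : H) : T.domToV (T.domAEquiv.symm k) = adjoint T.VtoH k := by
  refine ext_inner_right ℝ fun w => ?_
  rw [adjoint_inner_left]
  exact (T.inner_domA _ _).symm.trans (congrArg (inner ℝ · _) (T.domAEquiv.apply_symm_apply k))

theorem realRiesz_HtoDualV (h : H) : realRiesz T.Energy (T.HtoDualV h) = adjoint T.VtoH h := by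
  refine ext_inner_right ℝ fun w => ?_
  rw [inner_realRiesz, adjoint_inner_left]
  rfl

/-- The identification of `D(A)'` with `H` that corresponds to `A⁻¹`, the inverse of the extension
`A : H → D(A)'`. -/
noncomputable def dualDomEquiv : T.DualDom ≃L[ℝ] H :=
  (T.domAEquiv.toContinuousLinearEquiv.arrowCongr (ContinuousLinearEquiv.refl ℝ ℝ)).trans
    (realRiesz H).toContinuousLinearEquiv

theorem inner_dualDomEquiv (f : T.DualDom) (k : H) :
    inner ℝ (T.dualDomEquiv f) k = f (T.domAEquiv.symm k) :=
  inner_realRiesz _ _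

theorem dualDomEquiv_dualVToDualDom (f : T.DualV) :
    T.dualDomEquiv (T.dualVToDualDom f) = T.VtoH (realRiesz T.Energy f) := by
  refine ext_inner_right ℝ fun k => ?_
  rw [inner_dualDomEquiv, ← adjoint_inner_right, inner_realRiesz, ← domToV_domAEquiv_symm]
  rfl

theorem dualDomEquiv_HtoDualDom (h : H) :
    T.dualDomEquiv (T.HtoDualDom h) = T.VtoH (adjoint T.VtoH h) := by
  rw [← realRiesz_HtoDualV, ← dualDomEquiv_dualVToDualDom]
  rfl

theorem dualDomEquiv_AHtoDualDom (h : H) : T.dualDomEquiv (T.AHtoDualDom h) = h := by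
  refine ext_inner_right ℝ fun k => ?_
  rw [inner_dualDomEquiv]
  exact congrArg (inner ℝ h) (T.domAEquiv.apply_symm_apply k)

theorem mul_norm_domToV_sq_le {n : ℕ} {d : Fin n → T.DualDom} {k : ℝ}
    (hk : k ≤ T.poincareConst d) {v : T.Dom} (hv : ∀ j, d j v = 0) :
    k * ‖T.domToV v‖ ^ 2 ≤ ‖v‖ ^ 2 := by
  rcases eq_or_ne v 0 with rfl | hne
  · simp
  have hle : T.poincareConst d ≤ ‖v‖ ^ 2 / ‖T.domToV v‖ ^ 2 :=
    ciInf_le (f := fun Θ : {Θ : T.Dom // (∀ j, d j Θ = 0) ∧ Θ ≠ 0} =>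
      ‖Θ.1‖ ^ 2 / ‖T.domToV Θ.1‖ ^ 2) ⟨0, by rintro _ ⟨Θ, rfl⟩; positivity⟩ ⟨v, hv, hne⟩
  have hpos : 0 < ‖T.domToV v‖ := norm_pos_iff.2 fun h => hne (T.domVal_injective h)
  exact (le_div_iff₀ (by positivity)).1 (hk.trans hle)

/-- The coercivity of `A` penalised by the observations `⟨d j, ·⟩`: up to half of `‖v‖²_{D(A)}`,
they bound `κ ‖v‖²_V`. -/
def IsPenalizedCoercive {n : ℕ} (d : Fin n → T.DualDom) (κ lam : ℝ) : Prop :=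
  ∀ v : T.Dom, κ * ‖T.domToV v‖ ^ 2 ≤ 1 / 2 * ‖v‖ ^ 2 + lam * ∑ j, d j v ^ 2

/-- The operator `h ↦ A h + A_rc h + λ ∑ⱼ ⟨dⱼ, A⁻¹ h⟩ dⱼ`, with `D(A)'` identified with `H`. -/
noncomputable def loop (Arc : ℝ → H →L[ℝ] T.DualV) (lam : ℝ) {n : ℕ} (d : Fin n → T.DualDom)
    (t : ℝ) : H →L[ℝ] H :=
  closedLoop T.VtoH ((realRiesz T.Energy).toLinearIsometry.toContinuousLinearMap ∘L Arc t) lam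
    fun i => T.dualDomEquiv (d i)

section Loop

variable {T} {Arc : ℝ → H →L[ℝ] T.DualV} {C μ lam : ℝ} {n : ℕ} {d : Fin n → T.DualDom}

theorem dualDomEquiv_symm_loop (t : ℝ) (h : H) :
    T.dualDomEquiv.symm (T.loop Arc lam d t h) = T.AHtoDualDom h + T.dualVToDualDom (Arc t h)
      + lam • ∑ j, d j (T.domAEquiv.symm h) • d j := by
  rw [ContinuousLinearEquiv.symm_apply_eq, map_add, map_add, map_smul, map_sum,
    dualDomEquiv_AHtoDualDom, dualDomEquiv_dualVToDualDom]
  simp only [map_smul, ← inner_dualDomEquiv]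
  exact closedLoop_apply _ _ _ _ _

theorem IsReactionConvection.isBoundedFamily_loop (hA : T.IsReactionConvection Arc C) :
    IsBoundedFamily (T.loop Arc lam d) (volume.restrict (Ioi 0)) := by
  refine isBoundedFamily_closedLoop (C := C) (fun h x => ?_) (hA.bound.mono fun t ht => ?_)
  · exact (hA.aemeasurable h x).congr (.of_forall fun t => (inner_realRiesz (Arc t h) x).symm)
  · rwa [LinearIsometry.norm_toContinuousLinearMap_comp]

theorem IsReactionConvection.loop_coercive (hA : T.IsReactionConvection Arc C)
    (hd : T.IsPenalizedCoercive d (C ^ 2 + μ) lam) :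
    ∀ᵐ t ∂volume.restrict (Ioi (0 : ℝ)), ∀ h,
      1 / 4 * ‖h‖ ^ 2 + μ * ‖adjoint T.VtoH h‖ ^ 2 ≤ inner ℝ (T.loop Arc lam d t h) h := by
  filter_upwards [hA.bound] with t ht
  refine closedLoop_coercive (C := C) ?_ fun h => ?_
  · rwa [LinearIsometry.norm_toContinuousLinearMap_comp]
  · simpa only [inner_dualDomEquiv, domToV_domAEquiv_symm, LinearIsometryEquiv.norm_map]
      using hd (T.domAEquiv.symm h)

end Loop

end DiffusionOperator

namespace DiffusionOperator

open ContinuousLinearMap (adjoint)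

variable {V H : Type*}
  [NormedAddCommGroup V] [InnerProductSpace ℝ V] [CompleteSpace V]
  [NormedAddCommGroup H] [InnerProductSpace ℝ H] [CompleteSpace H]
  {T : DiffusionOperator V H} {Arc : ℝ → H →L[ℝ] T.DualV} {C μ lam : ℝ}
  {n : ℕ} {d : Fin n → T.DualDom} {y₀ : T.DualV} {y w : ℝ → T.DualV} {yH wH : ℝ → H}

theorem IsSolution.isStrongSolution (h : T.IsSolution Arc lam d y₀ y yH) :
    IsStrongSolution T.VtoH (T.loop Arc lam d) (fun t => realRiesz T.Energy (y t)) yH := by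
  obtain ⟨y', hy', hderiv, heq⟩ := h.equation
  have hz : ContinuousOn (fun t => realRiesz T.Energy (y t)) (Ici 0) :=
    (realRiesz T.Energy).continuous.comp_continuousOn h.continuousOn
  have hae : ∀ᵐ t ∂volume.restrict (Ioi (0 : ℝ)),
      realRiesz T.Energy (y t) = adjoint T.VtoH (yH t) := by
    filter_upwards [h.ae_eq] with t ht
    rw [ht, realRiesz_HtoDualV]
  have hrhs : (fun t => T.dualDomEquiv (y' t)) =ᵐ[volume.restrict (Ici 0)]
      fun t => -T.loop Arc lam d t (yH t) := by
    rw [← restrict_Ioi_eq_restrict_Ici]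
    filter_upwards [heq] with t ht
    rw [← ContinuousLinearEquiv.eq_symm_apply, map_neg, dualDomEquiv_symm_loop,
      eq_neg_iff_add_eq_zero, ← add_assoc, ← add_assoc, ht, neg_add_cancel]
  have hderiv' : IsDistribDeriv (Ioi 0) (fun t => T.VtoH (realRiesz T.Energy (y t)))
      fun t => T.dualDomEquiv (y' t) := by
    refine (hderiv.map T.dualDomEquiv).congr_left ?_
    filter_upwards [hae] with t ht
    rw [dualDomEquiv_HtoDualDom, ht]
  have hint : ∀ a ∈ Ici (0 : ℝ), ∀ b ∈ Ici (0 : ℝ),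
      IntervalIntegrable (fun t => T.dualDomEquiv (y' t)) volume a b := fun a ha b hb =>
    intervalIntegrable_of_memLp one_le_two ordConnected_uIcc
      ((T.dualDomEquiv.toContinuousLinearMap.comp_memLp' (hy' _
        (add_pos_of_nonneg_of_pos (le_max_of_le_left ha) one_pos))).mono_measure
          (restrict_uIcc_le_restrict_Ioo ha hb)) left_mem_uIcc right_mem_uIcc
  have hprim := hderiv'.isPrimitiveOn_Ici (T.VtoH.continuous.comp_continuousOn hz) hint
  exact ⟨hz, hprim.congr_ae ordConnected_Ici hrhs, hae, h.memLp⟩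

theorem isDistribDeriv_HtoDualDom {N : ℝ → H →L[ℝ] H} {z : ℝ → T.Energy}
    (h : IsStrongSolution T.VtoH N z yH) :
    IsDistribDeriv (Ioi 0) (fun t => T.HtoDualDom (yH t))
      fun t => T.dualDomEquiv.symm (-N t (yH t)) := by
  refine (((h.isPrimitiveOn.mono Ioi_subset_Ici_self).isDistribDeriv isOpen_Ioi).map
    T.dualDomEquiv.symm).congr_left ?_
  filter_upwards [h.ae_eq] with t ht
  rw [ContinuousLinearEquiv.symm_apply_eq, dualDomEquiv_HtoDualDom, ht]

theorem isSolution_of_isStrongSolution (hA : T.IsReactionConvection Arc C)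
    (h : IsStrongSolution T.VtoH (T.loop Arc lam d) (fun t => realRiesz T.Energy (y t)) yH) :
    T.IsSolution Arc lam d (y 0) y yH where
  continuousOn := by
    simpa [Function.comp_def] using
      (realRiesz T.Energy).symm.continuous.comp_continuousOn h.continuousOn
  initial := rfl
  ae_eq := by
    filter_upwards [h.ae_eq] with t ht
    rwa [← realRiesz_HtoDualV, (realRiesz T.Energy).injective.eq_iff] at ht
  memLp := h.memLp
  equation := by
    have := T.separableSpace
    refine ⟨_, fun τ hτ => T.dualDomEquiv.symm.toContinuousLinearMap.comp_memLp' <|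
      ((hA.isBoundedFamily_loop.mono_measure
        (Measure.restrict_mono Ioo_subset_Ioi_self le_rfl)).memLp_apply (h.memLp τ hτ)).neg,
      isDistribDeriv_HtoDualDom h, .of_forall fun t => ?_⟩
    simp only [Function.comp_apply, ContinuousLinearEquiv.coe_coe, Pi.neg_apply, map_neg,
      dualDomEquiv_symm_loop]
    abel

theorem memW_HtoDualDom {N : ℝ → H →L[ℝ] H} {z : ℝ → T.Energy}
    (h : IsStrongSolution T.VtoH N z yH) (hN : IsBoundedFamily N (volume.restrict (Ioi 0)))
    (hy : MemLp yH 2 (volume.restrict (Ioi 0))) : MemW T.HtoDualDom (Ioi 0) yH :=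
  have := T.separableSpace
  ⟨hy, _, T.dualDomEquiv.symm.toContinuousLinearMap.comp_memLp' (hN.memLp_apply hy).neg,
    isDistribDeriv_HtoDualDom h⟩

theorem IsSolution.norm_le_exp_mul (h : T.IsSolution Arc lam d y₀ y yH)
    (hA : T.IsReactionConvection Arc C) (hd : T.IsPenalizedCoercive d (C ^ 2 + μ) lam)
    {s t : ℝ} (hs : 0 ≤ s) (hst : s ≤ t) :
    ‖y t‖ ≤ Real.exp (-(μ * (t - s))) * ‖y s‖ := by
  have := T.separableSpace
  obtain ⟨I, _, ⟨B⟩⟩ :=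
    exists_singularBasis T.isCompactOperator_VtoH T.denseRange_VtoH T.VtoH_injective
  have hz := h.isStrongSolution.norm_le_exp_mul B hA.isBoundedFamily_loop
    ((hA.loop_coercive hd).mono fun t ht k =>
      (le_add_of_nonneg_left (by positivity)).trans (ht k)) hs hst
  simpa only [LinearIsometryEquiv.norm_map] using hz

theorem IsSolution.eqOn (hw : T.IsSolution Arc lam d y₀ w wH) (h : T.IsSolution Arc lam d y₀ y yH)
    (hA : T.IsReactionConvection Arc C) (hμ : 0 ≤ μ)
    (hd : T.IsPenalizedCoercive d (C ^ 2 + μ) lam) : EqOn w y (Ici 0) := by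
  have := T.separableSpace
  obtain ⟨I, _, ⟨B⟩⟩ :=
    exists_singularBasis T.isCompactOperator_VtoH T.denseRange_VtoH T.VtoH_injective
  have hz := hw.isStrongSolution.eqOn h.isStrongSolution B hA.isBoundedFamily_loop
    ((hA.loop_coercive hd).mono fun t ht k => le_trans (by positivity) (ht k))
    (by rw [hw.initial, h.initial])
  exact fun t ht => (realRiesz T.Energy).injective (hz ht)

theorem IsSolution.integral_norm_sq_le (h : T.IsSolution Arc lam d y₀ y yH)
    (hy : MemLp yH 2 (volume.restrict (Ioi 0))) (hA : T.IsReactionConvection Arc C) (hμ : 0 ≤ μ)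
    (hd : T.IsPenalizedCoercive d (C ^ 2 + μ) lam) {s : ℝ} (hs : 0 ≤ s) :
    ∫ t in Ioi s, ‖yH t‖ ^ 2 ≤ 2 * ‖y s‖ ^ 2 := by
  have := T.separableSpace
  obtain ⟨I, _, ⟨B⟩⟩ :=
    exists_singularBasis T.isCompactOperator_VtoH T.denseRange_VtoH T.VtoH_injective
  have hz := h.isStrongSolution.integral_norm_sq_le (α := 1 / 4) B hA.isBoundedFamily_loop
    ((hA.loop_coercive hd).mono fun t ht k =>
      (le_add_of_nonneg_right (by positivity)).trans (ht k)) hy hs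
  rw [LinearIsometryEquiv.norm_map] at hz
  linarith

theorem exists_isSolution (hA : T.IsReactionConvection Arc C) (hμ : 0 ≤ μ)
    (hd : T.IsPenalizedCoercive d (C ^ 2 + μ) lam) (y₀ : T.DualV) :
    ∃ (y : ℝ → T.DualV) (yH : ℝ → H),
      T.IsSolution Arc lam d y₀ y yH ∧ MemW T.HtoDualDom (Ioi 0) yH := by
  have := T.separableSpace
  obtain ⟨I, _, ⟨B⟩⟩ :=
    exists_singularBasis T.isCompactOperator_VtoH T.denseRange_VtoH T.VtoH_injective
  obtain ⟨z, u, hz, hz₀, hu⟩ := exists_isStrongSolution (α := 1 / 4) B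
    (hA.isBoundedFamily_loop (lam := lam) (d := d)) (by norm_num)
    ((hA.loop_coercive hd).mono fun t ht k =>
      (le_add_of_nonneg_right (by positivity)).trans (ht k)) (realRiesz T.Energy y₀)
  have hy : T.IsSolution Arc lam d _ (fun t => (realRiesz T.Energy).symm (z t)) u :=
    isSolution_of_isStrongSolution hA (by simpa only [LinearIsometryEquiv.apply_symm_apply])
  rw [hz₀, LinearIsometryEquiv.symm_apply_apply] at hy
  exact ⟨_, u, hy, memW_HtoDualDom hz hA.isBoundedFamily_loop hu⟩

end DiffusionOperator

theorem exists_monotone_threshold {ξ : ℕ+ → ℝ} (h : Tendsto ξ atTop atTop) :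
    ∃ m : ℕ → ℕ+, Monotone m ∧ ∀ k M, m k ≤ M → (k : ℝ) ≤ ξ M := by
  choose f hf using fun k : ℕ => eventually_atTop.1 (h.eventually_ge_atTop (k : ℝ))
  exact ⟨partialSups f, (partialSups f).monotone, fun k M hM =>
    hf k M ((le_partialSups f k).trans hM)⟩

namespace DiffusionOperator

variable {V H : Type*}
  [NormedAddCommGroup V] [InnerProductSpace ℝ V] [CompleteSpace V]
  [NormedAddCommGroup H] [InnerProductSpace ℝ H] [CompleteSpace H]
  (T : DiffusionOperator V H)

theorem isPenalizedCoercive_of_biorthogonal {n : ℕ} {d : Fin n → T.DualDom} {Ψ : Fin n → T.Dom}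
    (hΨ : ∀ i j, d j (Ψ i) = if j = i then 1 else 0) {κ lam : ℝ} (hκ : 0 ≤ κ)
    (hξ : 8 * κ ≤ T.poincareConst d)
    (hlam : (1 / 2 + 2 * κ * ‖T.domToV‖ ^ 2) * ∑ i, ‖Ψ i‖ ^ 2 ≤ lam) :
    T.IsPenalizedCoercive d κ lam :=
  mul_norm_sq_le_of_biorthogonal T.domToV hΨ hκ
    (fun _ hv => T.mul_norm_domToV_sq_le hξ hv) hlam

theorem exists_monotone_isPenalizedCoercive {n : ℕ+ → ℕ} {d : ∀ M, Fin (n M) → T.DualDom}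
    {Ψ : ∀ M, Fin (n M) → T.Dom} (hΨ : ∀ M i j, d M j (Ψ M i) = if j = i then 1 else 0)
    (hξ : Tendsto (fun M => T.poincareConst (d M)) atTop atTop) :
    ∃ (Mbar : ℝ≥0 → ℕ+) (lamBar : ℕ+ × ℝ≥0 → ℝ),
      Monotone Mbar ∧ Monotone lamBar ∧ (∀ p, 0 < lamBar p) ∧
      ∀ κ M, Mbar κ ≤ M → ∀ lam, lamBar (M, κ) ≤ lam → T.IsPenalizedCoercive (d M) κ lam := by
  obtain ⟨m, hm, hmξ⟩ := exists_monotone_threshold hξ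
  let Q (M : ℕ+) : ℝ := ∑ i, ‖Ψ M i‖ ^ 2
  -- Partial sums, since `Q` need not be monotone.
  let G (M : ℕ+) : ℝ := ∑ k ∈ Finset.Icc 1 M, Q k
  have hQ (M) : 0 ≤ Q M := Finset.sum_nonneg fun i _ => sq_nonneg _
  have hG (M) : 0 ≤ G M := Finset.sum_nonneg fun k _ => hQ k
  have hG_mono : Monotone G := fun M M' hM =>
    Finset.sum_le_sum_of_subset_of_nonneg (Finset.Icc_subset_Icc_right hM) fun k _ _ => hQ k
  have hQG (M) : Q M ≤ G M :=
    Finset.single_le_sum (f := Q) (fun k _ => hQ k) (Finset.mem_Icc.2 ⟨one_le, le_rfl⟩)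
  refine ⟨fun κ => m ⌈8 * κ⌉₊, fun p => 1 + (1 / 2 + 2 * p.2 * ‖T.domToV‖ ^ 2) * G p.1,
    fun κ κ' hκ => hm (Nat.ceil_mono (by gcongr)), fun p q hpq => ?_, fun p => ?_,
    fun κ M hM lam hlam => ?_⟩
  · have hpq₁ := hG_mono hpq.1
    have hpq₂ : (p.2 : ℝ) ≤ q.2 := hpq.2
    have := hG p.1
    beta_reduce
    gcongr
  · have := hG p.1
    positivity
  · refine T.isPenalizedCoercive_of_biorthogonal (hΨ M) κ.2
      ((?_ : 8 * (κ : ℝ) ≤ _).trans (hmξ _ M hM)) (le_trans ?_ hlam)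
    · exact_mod_cast Nat.le_ceil (8 * κ)
    · refine le_add_of_nonneg_of_le zero_le_one ?_
      gcongr
      exact hQG M

end DiffusionOperator

theorem theorem3p1_general {V H : Type*}
    [NormedAddCommGroup V] [InnerProductSpace ℝ V] [CompleteSpace V]
    [NormedAddCommGroup H] [InnerProductSpace ℝ H] [CompleteSpace H]
    (T : DiffusionOperator V H) {n : ℕ+ → ℕ} {d : ∀ M, Fin (n M) → T.DualDom}
    {Ψ : ∀ M, Fin (n M) → T.Dom} (hΨ : ∀ M i j, d M j (Ψ M i) = if j = i then 1 else 0)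
    (hξ : Tendsto (fun M => T.poincareConst (d M)) atTop atTop) :
    ∃ (Mbar : ℝ≥0 × ℝ≥0 → ℕ+) (lamBar : ℕ+ × ℝ≥0 × ℝ≥0 → ℝ),
      Monotone Mbar ∧ Monotone lamBar ∧ (∀ p, 0 < lamBar p) ∧
      ∀ (μ C : ℝ≥0) (Arc : ℝ → H →L[ℝ] T.DualV), T.IsReactionConvection Arc C →
      ∀ M : ℕ+, Mbar (μ, C) ≤ M → ∀ lam : ℝ, lamBar (M, μ, C) ≤ lam →
      ∀ y₀ : T.DualV,
        ∃ (y : ℝ → T.DualV) (yH : ℝ → H),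
          T.IsSolution Arc lam (d M) y₀ y yH ∧
          (∀ (w : ℝ → T.DualV) (wH : ℝ → H),
            T.IsSolution Arc lam (d M) y₀ w wH → EqOn w y (Ici 0)) ∧
          MemW T.HtoDualDom (Ioi 0) yH ∧
          (∀ s t : ℝ, 0 ≤ s → s ≤ t → ‖y t‖ ≤ Real.exp (-(μ * (t - s))) * ‖y s‖) ∧
          (∀ s : ℝ, 0 ≤ s → ∫ t in Ioi s, ‖yH t‖ ^ 2 ≤ 2 * ‖y s‖ ^ 2) := by
  obtain ⟨Mbar, lamBar, hMbar, hlamBar, hpos, hcoercive⟩ :=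
    T.exists_monotone_isPenalizedCoercive hΨ hξ
  let κ (p : ℝ≥0 × ℝ≥0) : ℝ≥0 := p.2 ^ 2 + p.1
  have hκ : Monotone κ := fun p q hpq => add_le_add (pow_le_pow_left' hpq.2 2) hpq.1
  refine ⟨Mbar ∘ κ, lamBar ∘ Prod.map id κ, hMbar.comp hκ, hlamBar.comp (monotone_id.prodMap hκ),
    fun p => hpos _, fun μ C Arc hA M hM lam hlam y₀ => ?_⟩
  have hd : T.IsPenalizedCoercive (d M) ((C : ℝ) ^ 2 + μ) lam := by
    simpa [κ] using hcoercive _ M hM lam hlam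
  obtain ⟨y, yH, hy, hW⟩ := T.exists_isSolution hA μ.2 hd y₀
  exact ⟨y, yH, hy, fun w wH hw => hw.eqOn hy hA μ.2 hd, hW,
    fun s t hs hst => hy.norm_le_exp_mul hA hd hs hst,
    fun s hs => hy.integral_norm_sq_le hW.1 hA μ.2 hd hs⟩

theorem theorem3p1 {V H : Type*}
    [NormedAddCommGroup V] [InnerProductSpace ℝ V] [CompleteSpace V]
    [NormedAddCommGroup H] [InnerProductSpace ℝ H] [CompleteSpace H]
    (T : DiffusionOperator V H) (σ : ℕ+ → ℕ+) (d : (M : ℕ+) → Fin (σ M) → T.DualDom)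
    (hd : T.IsActuatorSequence σ d) :
    ∃ (Mbar : ℝ≥0 × ℝ≥0 → ℕ+) (lamBar : ℕ+ × ℝ≥0 × ℝ≥0 → ℝ),
      Monotone Mbar ∧ Monotone lamBar ∧ (∀ p, 0 < lamBar p) ∧
      ∀ (μ C : ℝ≥0), 0 < μ →
      ∀ Arc : ℝ → H →L[ℝ] T.DualV, T.IsReactionConvection Arc C →
      ∀ M : ℕ+, Mbar (μ, C) ≤ M → ∀ lam : ℝ, lamBar (M, μ, C) ≤ lam →
      ∀ y₀ : T.DualV,
        ∃ (y : ℝ → T.DualV) (yH : ℝ → H),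
          T.IsSolution Arc lam (d M) y₀ y yH ∧
          (∀ (w : ℝ → T.DualV) (wH : ℝ → H),
            T.IsSolution Arc lam (d M) y₀ w wH → EqOn w y (Ici 0)) ∧
          MemW T.HtoDualDom (Ioi 0) yH ∧
          (∀ s t : ℝ, 0 ≤ s → s ≤ t → ‖y t‖ ≤ Real.exp (-(μ * (t - s))) * ‖y s‖) ∧
          (∀ s : ℝ, 0 ≤ s →
            ∫ t in Ioi s, ‖yH t‖ ^ 2 ≤ (2 + (μ : ℝ)⁻¹ * (C : ℝ) ^ 2) * ‖y s‖ ^ 2) := by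
  obtain ⟨Ψ, -, hΨ⟩ := hd.exists_auxiliary
  obtain ⟨Mbar, lamBar, hMbar, hlamBar, hpos, hsol⟩ :=
    theorem3p1_general T hΨ hd.tendsto_poincareConst
  refine ⟨Mbar, lamBar, hMbar, hlamBar, hpos, fun μ C _ Arc hA M hM lam hlam y₀ => ?_⟩
  obtain ⟨y, yH, hy, huniq, hW, hdecay, hint⟩ := hsol μ C Arc hA M hM lam hlam y₀
  exact ⟨y, yH, hy, huniq, hW, hdecay, fun s hs => (hint s hs).trans <|
    mul_le_mul_of_nonneg_right (le_add_of_nonneg_right (by positivity)) (sq_nonneg _)⟩
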